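/- Let $K$ be a totally real number field with ring of integers $\mathcal{O}_K$. For every $n \ge 0$ the orders of the finite subgroups of $\mathrm{GL}_n(\mathcal{O}_K)$ have a maximum, denoted $M_n$. For fixed $K$, $$\log M_n \le n\log n + O(n) \qquad\text{as } n\to\infty.$$ In particular, if $K$ is a real quadratic field, then, as $n\to\infty$, $$\log M_n \le \begin{cases} n\log n + \left(\mathcal{A}+\frac{\log 2}{2}\right)n + O(\sqrt n\,\log n) & \text{if } K=\mathbb{Q}(\sqrt2),\\[4pt] n\log n + \left(\mathcal{A}+\frac{p\log p}{(p-1)^2}\right)n + O(\sqrt n\,\log n) & \text{if } K=\mathbb{Q}(\sqrt p) \text{ with } p \text{ prime},\ p\equiv 1 \pmod 4,\\[4pt] n\log n + \mathcal{A}\,n + O(\sqrt n\,\log n) & \text{otherwise,}\end{cases}$$ where the implied constants may depend on $K$ and $\mathcal{A}$ is the real constant $$\mathcal{A} := \frac{\log 2}{2} - 1 + \sum_{\ell \text{ prime}} \frac{\log \ell}{(\ell-1)^2} = 0.57354\dots,$$ the series being convergent (so $0.57354\le\mathcal{A}<0.57355$). -/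

import Mathlib

open Filter Asymptotics NumberField

/-- The set of orders of the finite subgroups of `GL_n(R)`. -/
def finiteSubgroupOrders (R : Type*) [CommRing R] (n : ℕ) : Set ℕ :=
  {m | ∃ G : Subgroup (GL (Fin n) R), Finite G ∧ Nat.card G = m}

/-- The maximal order `M_n` of a finite subgroup of `GL_n(R)`. The supremum is the maximum when the
set of orders is bounded (and is the junk value `0` otherwise). -/
noncomputable def maxFiniteSubgroupOrder (R : Type*) [CommRing R] (n : ℕ) : ℕ :=
  sSup (finiteSubgroupOrders R n)

/-- `f n ≤ g n + O(e n)` as `n → ∞`. -/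
def LEUpToBigO (f g e : ℕ → ℝ) : Prop :=
  ∃ r : ℕ → ℝ, r =O[atTop] e ∧ ∀ᶠ n in atTop, f n ≤ g n + r n

/-- `K = ℚ(√m)`: the field `K` is generated over `ℚ` by a square root of `m`. -/
def IsRationalsAdjoinSqrt (K : Type*) [Field K] [Algebra ℚ K] (m : ℕ) : Prop :=
  ∃ x : K, x ^ 2 = (m : K) ∧ IntermediateField.adjoin ℚ {x} = ⊤

/-- The general term `log ℓ / (ℓ - 1)²` of the prime sum defining the constant `𝒜`. -/
noncomputable def schurTerm (l : Nat.Primes) : ℝ :=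
  Real.log ((l : ℕ) : ℝ) / (((l : ℕ) : ℝ) - 1) ^ 2

/-- The constant `𝒜 = (log 2) / 2 - 1 + ∑_ℓ log ℓ / (ℓ - 1)²`, the sum being over all primes. -/
noncomputable def schurConstant : ℝ :=
  Real.log 2 / 2 - 1 + ∑' l : Nat.Primes, schurTerm l

/-! The order of a finite group is bounded one prime at a time, by Schur's method. By Sylow it
suffices to treat a `p`-group. If the polynomials `Φ_{p^j}` are irreducible over the field `F`, the
characteristic polynomial of an element of a `p`-group acting on `F^N` is a product of such
polynomials. Its trace is therefore `N - p b` with `(p - 1) b ≤ N`, and `b = 0` only for the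
identity. The power sums of a character are multiples of the group order, so the order divides `∏ (p
b)` over `1 ≤ b ≤ N / (p - 1)` (`Representation.card_dvd_of_isPGroup`). This gives the exponent
bound `⌊n / (p - 1)⌋ + n / (p - 1)²`.

Irreducibility over `K` can fail only at primes dividing the discriminant. There the action is
viewed over `ℚ`, in dimension `n [K : ℚ]`, which costs a multiple of `n`. For real quadratic `K`,
failure forces `√2 ∈ K` or `√p ∈ K` with `p ≡ 1 [MOD 4]`. The case `√2` is sharpened by a congruence
modulo a prime above `2`, which makes `b` even over `ℚ`.

Summing over `p`, Legendre's formula turns `∑ ⌊n / (p - 1)⌋ log p` into `log n!` plus a digit sum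
error, which is `O(√n log n)` (`sum_div_sub_one_mul_log_le`). The terms `n log p / (p - 1)²` add up
to the prime series in `𝒜`.

For the numerical value, `1 / (x - 1)²` is split as `1 / (x² - 1) + 2 / (x³ - 1) + 2 / (x⁴ - 1)`
plus a remainder of order `x⁻⁵`. The sums `∑ log p / (p^k - 1)` equal `-ζ'(k) / ζ(k)` and are
computed by summation over all integers; the remainder is summed directly over small primes. -/

theorem LinearMap.trace_eq_neg_nextCoeff_charpoly {F V : Type*} [Field F] [AddCommGroup V]
    [Module F V] [FiniteDimensional F V] (f : V →ₗ[F] V) :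
    LinearMap.trace F V f = -f.charpoly.nextCoeff := by
  classical
  let b := Module.finBasis F V
  rw [LinearMap.trace_eq_matrix_trace F b, Matrix.trace_eq_neg_charpoly_nextCoeff,
    LinearMap.charpoly_toMatrix]

/-! ### Power sums of characters and Schur's divisibility. -/

namespace Representation

universe u

variable {G F : Type*} {V W : Type u} [Group G] [Fintype G] [Field F] [CharZero F]
  [AddCommGroup V] [Module F V] [FiniteDimensional F V]

theorem exists_sum_character_eq (ρ : Representation F G V) :
    ∃ m : ℕ, ∑ g, ρ.character g = (m : F) * Nat.card G := by
  have h0 : (Nat.card G : F) ≠ 0 := by exact_mod_cast Nat.card_pos.ne'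
  have := invertibleOfNonzero h0
  refine ⟨Module.finrank F ρ.invariants, ?_⟩
  rw [← ρ.card_inv_mul_sum_char_eq_finrank]
  field_simp

/-- The sum is `|G|` times the dimension of the invariants of `ρ^{⊗k} ⊗ σ`. Letting `σ` vary in the
induction absorbs one tensor factor at a time, so no iterated tensor power has to be formed. -/
theorem exists_sum_character_pow_mul_eq (ρ : Representation F G V) (k : ℕ)
    [AddCommGroup W] [Module F W] [FiniteDimensional F W] (σ : Representation F G W) :
    ∃ m : ℕ, ∑ g, ρ.character g ^ k * σ.character g = (m : F) * Nat.card G := by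
  induction k generalizing W with
  | zero => simpa using σ.exists_sum_character_eq
  | succ k ih =>
    obtain ⟨m, hm⟩ := ih (ρ.tprod σ)
    refine ⟨m, hm ▸ Finset.sum_congr rfl fun g _ => ?_⟩
    rw [char_tensor, Pi.mul_apply]
    ring

theorem exists_sum_character_pow_eq (ρ : Representation F G V) (k : ℕ) :
    ∃ m : ℕ, ∑ g, ρ.character g ^ k = (m : F) * Nat.card G := by
  cases k with
  | zero => exact ⟨1, by simp [Nat.card_eq_fintype_card]⟩
  | succ k => simpa only [pow_succ] using ρ.exists_sum_character_pow_mul_eq k ρ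

open Polynomial in
/-- **Schur's divisibility**: the order of the group divides `∏ (χ(1) - v)`, the product being over
a set of integers containing all the values of the integral character `χ` off the identity. -/
theorem card_dvd_prod_finrank_sub (ρ : Representation F G V) (c : G → ℤ)
    (hc : ∀ g, ρ.character g = c g) (s : Finset ℤ) (hs : ∀ g, g ≠ 1 → c g ∈ s) :
    (Nat.card G : ℤ) ∣ ∏ v ∈ s, ((Module.finrank F V : ℤ) - v) := by
  classical
  have hc1 : c 1 = Module.finrank F V := by
    have := hc 1
    rw [char_one] at this
    exact_mod_cast this.symm
  have hpow : ∀ k : ℕ, (Nat.card G : ℤ) ∣ ∑ g, c g ^ k := fun k => by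
    obtain ⟨m, hm⟩ := ρ.exists_sum_character_pow_eq k
    refine ⟨m, ?_⟩
    simp only [hc] at hm
    rw [mul_comm]
    exact_mod_cast hm
  let P : ℤ[X] := ∏ v ∈ s, (X - C v)
  have hP : ∀ x, P.eval x = ∏ v ∈ s, (x - v) := fun x => by simp [P, eval_prod]
  -- `∑ P(χ(g))` is an integral combination of power sums of `χ`, each a multiple of `|G|`. Since
  -- `P` vanishes at every value off the identity, only `P(χ(1))` remains.
  have hsum : (Nat.card G : ℤ) ∣ ∑ g, P.eval (c g) := by
    simp only [eval_eq_sum_range]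
    rw [Finset.sum_comm]
    refine Finset.dvd_sum fun k _ => ?_
    rw [← Finset.mul_sum]
    exact (hpow k).mul_left _
  rw [Finset.sum_eq_single 1] at hsum
  · rwa [hP, hc1] at hsum
  · intro g _ hg
    rw [hP]
    exact Finset.prod_eq_zero (hs g hg) (sub_self _)
  · simp

end Representation

/-! ### Traces of elements of `p`-power order and Schur's bound for `p`-groups. -/

section PrimePowerOrder

open Polynomial

variable {F : Type*} [Field F]

/-- The shape of the degree and the trace of a polynomial that is a product of cyclotomic
polynomials of `p`-power conductor. -/
structure TraceShape (p : ℕ) (q : F[X]) (b : ℕ) : Prop where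
  nextCoeff_eq : q.nextCoeff = -((q.natDegree : F) - p * b)
  le_natDegree : (p - 1) * b ≤ q.natDegree
  eq_of_eq_zero : b = 0 → q = (X - 1) ^ q.natDegree

theorem TraceShape.mul {p : ℕ} {q r : F[X]} {b c : ℕ} (hq : q.Monic) (hr : r.Monic)
    (h : TraceShape p q b) (h' : TraceShape p r c) : TraceShape p (q * r) (b + c) where
  nextCoeff_eq := by
    rw [hq.nextCoeff_mul hr, h.nextCoeff_eq, h'.nextCoeff_eq, hq.natDegree_mul hr]
    push_cast
    ring
  le_natDegree := by
    rw [hq.natDegree_mul hr, mul_add]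
    exact add_le_add h.le_natDegree h'.le_natDegree
  eq_of_eq_zero h0 := by
    rw [hq.natDegree_mul hr, pow_add, ← h.eq_of_eq_zero (by omega),
      ← h'.eq_of_eq_zero (by omega)]

/-- Only exponents divisible by `p ^ j` occur in `1 + X^{p^j} + ⋯ + X^{p^j (p - 1)}`. For `j ≥ 1`
the exponent just below the degree is not one of them. -/
theorem nextCoeff_cyclotomic_prime_pow {p : ℕ} (hp : p.Prime) (j : ℕ) :
    (cyclotomic (p ^ (j + 1)) F).nextCoeff = if j = 0 then 1 else 0 := by
  have hdeg : (cyclotomic (p ^ (j + 1)) F).natDegree = p ^ j * (p - 1) := by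
    rw [natDegree_cyclotomic, Nat.totient_prime_pow_succ hp]
  have h1 := hp.two_le
  have hpos : 0 < p ^ j * (p - 1) := Nat.mul_pos (pow_pos hp.pos _) (by omega)
  rw [nextCoeff_of_natDegree_pos (hdeg ▸ hpos), hdeg, cyclotomic_prime_pow_eq_geom_sum hp]
  simp only [← pow_mul, finsetSum_coeff, coeff_X_pow]
  split_ifs with hj
  · subst hj
    rw [Finset.sum_eq_single (p - 2)]
    · simp; omega
    · intro i _ hi
      rw [if_neg]
      simp; omega
    · intro h
      exact absurd (Finset.mem_range.2 (by omega)) h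
  · refine Finset.sum_eq_zero fun i _ => if_neg fun h => ?_
    have hpj : p ∣ p ^ j := dvd_pow_self p hj
    have h2 : p ∣ p ^ j * (p - 1) - 1 := h ▸ hpj.mul_right i
    have h3 := (Nat.dvd_sub_iff_right (by omega) (hpj.mul_right (p - 1))).1 h2
    exact hp.one_lt.ne' (Nat.dvd_one.1 h3)

/-- The roots of `Φ_{p^j}` have sum `1`, `-1`, `0` for `j = 0`, `j = 1`, `j ≥ 2`. Solving `degree -
p b = sum` gives `b = 0`, `b = 1`, `b = p ^ (j - 2) * (p - 1)`. -/
theorem traceShape_cyclotomic {p : ℕ} (hp : p.Prime) (j : ℕ) :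
    ∃ b, TraceShape p (cyclotomic (p ^ j) F) b := by
  have h2 := hp.two_le
  obtain ⟨q, rfl⟩ : ∃ q, p = q + 2 := ⟨p - 2, by omega⟩
  match j with
  | 0 =>
    have hd : (X - 1 : F[X]).natDegree = 1 := by simpa using natDegree_X_sub_C (1 : F)
    have hn : (X - 1 : F[X]).nextCoeff = -1 := by simpa using nextCoeff_X_sub_C (1 : F)
    exact ⟨0, by simp [hd, hn], by simp, by simp [hd]⟩
  | 1 =>
    refine ⟨1, ?_, ?_, by simp⟩
    · rw [nextCoeff_cyclotomic_prime_pow hp 0, natDegree_cyclotomic, pow_one, Nat.totient_prime hp]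
      push_cast [Nat.add_succ_sub_one]
      simp
      ring
    · rw [natDegree_cyclotomic, pow_one, Nat.totient_prime hp]
      simp
  | j + 2 =>
    refine ⟨(q + 2) ^ j * (q + 1), ?_, ?_, ?_⟩
    · rw [nextCoeff_cyclotomic_prime_pow hp (j + 1), natDegree_cyclotomic,
        Nat.totient_prime_pow_succ hp]
      simp only [Nat.add_succ_sub_one]
      push_cast
      simp
      ring
    · rw [natDegree_cyclotomic, Nat.totient_prime_pow_succ hp]
      simp only [Nat.add_succ_sub_one]
      rw [pow_succ, mul_assoc, mul_comm (q + 1)  (_ * _), mul_assoc]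
      gcongr
      omega
    · intro h
      have : 0 < (q + 2) ^ j * (q + 1) := by positivity
      omega

/-- Product decomposition of a monic polynomial all of whose irreducible factors divide
`X ^ p ^ k - 1`. -/
theorem exists_traceShape {p : ℕ} (hp : p.Prime) (hirr : ∀ j, Irreducible (cyclotomic (p ^ j) F))
    {k : ℕ} {q : F[X]} (hq : q.Monic)
    (hdvd : ∀ r : F[X], Irreducible r → r ∣ q → r ∣ X ^ p ^ k - 1) :
    ∃ b, TraceShape p q b := by
  induction h : q.natDegree using Nat.strong_induction_on generalizing q with
  | _ d ih =>
  by_cases hu : IsUnit q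
  · have : q = 1 := hq.eq_one_of_isUnit hu
    subst this
    exact ⟨0, by simp [nextCoeff], by simp, by simp⟩
  obtain ⟨r, hrm, hri, hrq⟩ := exists_monic_irreducible_factor q hu
  have h1 := hdvd r hri hrq
  rw [← prod_cyclotomic_eq_X_pow_sub_one (pow_pos hp.pos k), hri.prime.dvd_finsetProd_iff] at h1
  obtain ⟨i, hi, hri'⟩ := h1
  obtain ⟨j, -, rfl⟩ := (Nat.dvd_prime_pow hp).1 (Nat.dvd_of_mem_divisors hi)
  have hr : r = cyclotomic (p ^ j) F :=
    eq_of_monic_of_associated hrm (cyclotomic.monic _ _) (hri.associated_of_dvd (hirr j) hri')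
  obtain ⟨s, rfl⟩ := hrq
  have hs : s.Monic := hrm.of_mul_monic_left hq
  have hdeg : (r * s).natDegree = r.natDegree + s.natDegree := hrm.natDegree_mul hs
  have hrpos : 0 < r.natDegree := hri.natDegree_pos
  obtain ⟨b, hb⟩ := ih s.natDegree (by omega) hs
    (fun t ht hts => hdvd t ht (hts.mul_left r)) rfl
  obtain ⟨c, hc⟩ := traceShape_cyclotomic (F := F) hp j
  exact ⟨c + b, (hr ▸ hc).mul hrm hs hb⟩

variable {V : Type*} [AddCommGroup V] [Module F V] [FiniteDimensional F V]

/-- The root `α` of `r` in `AdjoinRoot r` is an eigenvalue of `f`, so `det (α - B) = 0`. As `α - B`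
divides `α ^ m - B ^ m`, which is the scalar `α ^ m - 1`, taking determinants gives `α ^ m = 1`. -/
theorem LinearMap.irreducible_dvd_X_pow_sub_one {f : V →ₗ[F] V} {m : ℕ} (hf : f ^ m = 1)
    {r : F[X]} (hr : Irreducible r) (hrf : r ∣ f.charpoly) : r ∣ X ^ m - 1 := by
  classical
  let b := Module.finBasis F V
  let A := LinearMap.toMatrix b b f
  have hA : A ^ m = 1 := by
    rw [LinearMap.toMatrix_pow, hf]
    exact LinearMap.toMatrix_one b
  have hrA : r ∣ A.charpoly := by rwa [LinearMap.charpoly_toMatrix]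
  have := Fact.mk hr
  let α := AdjoinRoot.root r
  let B := A.map (algebraMap F (AdjoinRoot r))
  have hB : B ^ m = 1 := by
    have := congrArg (RingHom.mapMatrix (algebraMap F (AdjoinRoot r))) hA
    rwa [map_pow, map_one] at this
  have hα : B.charpoly.eval α = 0 := by
    rw [Matrix.charpoly_map, eval_map_algebraMap]
    obtain ⟨s, hs⟩ := hrA
    rw [hs, map_mul, AdjoinRoot.aeval_eq, AdjoinRoot.mk_self, zero_mul]
  rw [Matrix.eval_charpoly] at hα
  have hdvd : (Matrix.scalar _ α - B) ∣ (Matrix.scalar _ α) ^ m - B ^ m :=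
    (Matrix.scalar_commute α (fun _ => Commute.all _ _) B).sub_dvd_pow_sub_pow m
  obtain ⟨C', hC⟩ := hdvd
  have hdet := congrArg Matrix.det hC
  rw [Matrix.det_mul, hα, zero_mul, hB, ← map_pow, ← map_one (Matrix.scalar _), ← map_sub,
    Matrix.scalar_apply, Matrix.det_diagonal, Finset.prod_const] at hdet
  have h1 : α ^ m - 1 = 0 := eq_zero_of_pow_eq_zero hdet
  rw [← AdjoinRoot.mk_eq_zero]
  simpa using h1

theorem LinearMap.exists_trace_eq_of_pow_eq_one [CharZero F] {p : ℕ} (hp : p.Prime)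
    (hirr : ∀ j, Irreducible (cyclotomic (p ^ j) F)) {k : ℕ} {f : V →ₗ[F] V}
    (hf : f ^ p ^ k = 1) :
    ∃ b : ℕ, LinearMap.trace F V f = ((Module.finrank F V - p * b : ℤ) : F) ∧
      (p - 1) * b ≤ Module.finrank F V ∧ (b = 0 → f = 1) := by
  obtain ⟨b, hb⟩ := exists_traceShape hp hirr f.charpoly_monic
    (fun r hr hrf => LinearMap.irreducible_dvd_X_pow_sub_one hf hr hrf)
  refine ⟨b, ?_, ?_, fun h0 => ?_⟩
  · rw [LinearMap.trace_eq_neg_nextCoeff_charpoly, hb.nextCoeff_eq, LinearMap.charpoly_natDegree]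
    push_cast
    ring
  · simpa [LinearMap.charpoly_natDegree] using hb.le_natDegree
  · have h1 := hb.eq_of_eq_zero h0
    have hsep : (X ^ p ^ k - 1 : F[X]).Separable :=
      separable_X_pow_sub_C 1 (by exact_mod_cast (pow_pos hp.pos k).ne') one_ne_zero
    have h2 : minpoly F f ∣ X ^ p ^ k - 1 := minpoly.dvd _ _ (by simp [hf])
    have h3 : minpoly F f ∣ (X - 1) ^ f.charpoly.natDegree := h1 ▸ f.minpoly_dvd_charpoly
    -- In characteristic zero `X ^ p ^ k - 1` is separable, so the minimal polynomial is squarefree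
    -- and the exponent can be dropped. The exponent is first raised by one because it is zero when
    -- `V = 0`.
    have h4 : minpoly F f ∣ X - 1 :=
      ((hsep.of_dvd h2).squarefree.dvd_pow_iff_dvd (Nat.succ_ne_zero _)).1
        (h3.trans (pow_dvd_pow _ (Nat.le_succ _)))
    obtain ⟨s, hs⟩ := h4
    have h5 := congrArg (aeval f) hs
    rw [map_mul, minpoly.aeval, zero_mul, map_sub, aeval_X, map_one] at h5
    exact sub_eq_zero.1 h5

/-- **Schur's bound** for a finite `p`-group acting faithfully over a field in which the cyclotomic
polynomials of `p`-power conductor are irreducible. -/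
theorem Representation.card_dvd_of_isPGroup {F G : Type*} [Field F] [CharZero F] [Group G]
    [Finite G] {V : Type*} [AddCommGroup V] [Module F V] [FiniteDimensional F V] {p : ℕ}
    (hp : p.Prime) (hirr : ∀ j, Irreducible (cyclotomic (p ^ j) F)) (hG : IsPGroup p G)
    (ρ : Representation F G V) (hρ : Function.Injective ρ) :
    Nat.card G ∣ p ^ (Module.finrank F V / (p - 1)) * (Module.finrank F V / (p - 1)).factorial := by
  have := Fintype.ofFinite G
  set N := Module.finrank F V / (p - 1) with hN
  have hp1 : 0 < p - 1 := Nat.sub_pos_of_lt hp.one_lt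
  have key : ∀ g : G, ∃ b : ℕ, ρ.character g = ((Module.finrank F V - p * b : ℤ) : F) ∧
      (p - 1) * b ≤ Module.finrank F V ∧ (b = 0 → g = 1) := fun g => by
    obtain ⟨k, hk⟩ := hG g
    obtain ⟨b, h1, h2, h3⟩ := LinearMap.exists_trace_eq_of_pow_eq_one hp hirr (f := ρ g) (k := k)
      (by rw [← map_pow, hk, map_one])
    exact ⟨b, h1, h2, fun h0 => hρ (by rw [h3 h0, map_one])⟩
  choose b hb1 hb2 hb3 using key
  have hinj : Set.InjOn (fun j : ℕ => (Module.finrank F V : ℤ) - p * (j + 1 : ℕ))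
      (Finset.range N) := fun i _ j _ h => by
    have h' : (p : ℤ) * (i + 1 : ℕ) = p * (j + 1 : ℕ) := by simpa using h
    have := mul_left_cancel₀ (by exact_mod_cast hp.ne_zero) h'
    push_cast at this
    omega
  -- Off the identity the character is `dim V - p * b` with `1 ≤ b ≤ N`, so the product of the
  -- differences is `∏ p * b = p ^ N * N!`.
  have h := ρ.card_dvd_prod_finrank_sub _ hb1
    ((Finset.range N).image fun j : ℕ => (Module.finrank F V : ℤ) - p * (j + 1 : ℕ)) ?_
  · rw [Finset.prod_image hinj] at h
    simp only [sub_sub_cancel] at h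
    rw [Finset.prod_mul_distrib, Finset.prod_const, Finset.card_range] at h
    rw [← Finset.prod_range_add_one_eq_factorial]
    exact_mod_cast h
  · intro g hg
    have h0 : b g ≠ 0 := fun h => hg (hb3 g h)
    refine Finset.mem_image.2 ⟨b g - 1, Finset.mem_range.2 ?_, by
      rw [Nat.sub_add_cancel (Nat.pos_of_ne_zero h0)]⟩
    have : b g ≤ N := (Nat.le_div_iff_mul_le hp1).2 (by rw [mul_comm]; exact hb2 g)
    omega

end PrimePowerOrder

/-! ### Irreducibility of cyclotomic polynomials of prime power conductor. -/

section IrreducibleCyclotomic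

open Polynomial IntermediateField

variable {K : Type*} [Field K]

/-- `Φ_{p^(j+1)}(X + 1)` is Eisenstein at `P`: its lower coefficients are multiples of `p`, and its
constant term is `p` itself, which is not in `P ^ 2`. Gauss's lemma for monic polynomials over an
integrally closed domain passes to `K`. -/
theorem irreducible_cyclotomic_of_notMem_sq {R K : Type*} [CommRing R] [IsDomain R]
    [IsIntegrallyClosed R] [Field K] [Algebra R K] [IsFractionRing R K] {p : ℕ} (hp : p.Prime)
    {P : Ideal R} (hP : P.IsPrime) (hmem : (p : R) ∈ P) (hsq : (p : R) ∉ P ^ 2) (j : ℕ) :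
    Irreducible (cyclotomic (p ^ j) K) := by
  have := Fact.mk hp
  cases j with
  | zero =>
    rw [pow_zero, cyclotomic_one]
    simpa using irreducible_X_sub_C (1 : K)
  | succ j =>
    rw [← map_cyclotomic _ (algebraMap R K),
      ← (cyclotomic.monic _ R).irreducible_iff_irreducible_map_fraction_map]
    have hE := cyclotomic_prime_pow_comp_X_add_one_isEisensteinAt p j
    let f : ℤ[X] := (cyclotomic (p ^ (j + 1)) ℤ).comp (X + 1)
    have hf : f.Monic := (cyclotomic.monic _ ℤ).comp (monic_X_add_C 1) (by
      rw [show (X + 1 : ℤ[X]) = X + C 1 by simp, natDegree_X_add_C]; exact one_ne_zero)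
    have hmap : f.map (Int.castRingHom R) = (cyclotomic (p ^ (j + 1)) R).comp (X + 1) := by
      simp [f, Polynomial.map_comp]
    have hdeg : f.natDegree = (p ^ (j + 1)).totient := by
      rw [natDegree_comp, natDegree_cyclotomic, show (X + 1 : ℤ[X]) = X + C 1 by simp,
        natDegree_X_add_C, mul_one]
    have hER : ((cyclotomic (p ^ (j + 1)) R).comp (X + 1)).IsEisensteinAt P := by
      rw [← hmap]
      refine (hf.map _).isEisensteinAt_of_mem_of_notMem hP.ne_top (fun {n} hn => ?_) ?_
      · rw [hf.natDegree_map] at hn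
        rw [coeff_map]
        have := hE.coeff_mem hn.ne
        rw [Ideal.submodule_span_eq, Ideal.mem_span_singleton] at this
        obtain ⟨c, hc⟩ := this
        rw [hc]
        simpa using P.mul_mem_right (c : R) hmem
      · have : f.coeff 0 = p := by
          rw [coeff_zero_eq_eval_zero, eval_comp, cyclotomic_prime_pow_eq_geom_sum hp]
          simp [eval_finsetSum]
        rw [coeff_map, this]
        simpa using hsq
    have hirr := hER.irreducible hP (hmap ▸ (hf.map _)).isPrimitive (by
      rw [← hmap, hf.natDegree_map, hdeg]
      exact Nat.totient_pos.2 (pow_pos hp.pos _))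
    have h2 := (MulEquiv.irreducible_iff (Polynomial.algEquivAevalXAddC (1 : R))
      (x := cyclotomic (p ^ (j + 1)) R))
    rw [← h2]
    simpa [comp, aeval_def] using hirr

/-- A prime `P` above an unramified `p` does not divide the different, whereas `p ∈ P ^ 2` would
make it do so. Hence the Eisenstein argument applies at `P`. -/
theorem irreducible_cyclotomic_of_not_dvd_discr [NumberField K] {p : ℕ} (hp : p.Prime)
    (hd : ¬ (p : ℤ) ∣ discr K) (j : ℕ) : Irreducible (cyclotomic (p ^ j) K) := by
  have hpI : Prime (p : ℤ) := Nat.prime_iff_prime_int.1 hp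
  have hu : ¬ IsUnit ((p : ℤ) : 𝓞 K) := by
    intro h
    have := h.map (Algebra.norm ℤ)
    rw [show ((p : ℤ) : 𝓞 K) = algebraMap ℤ (𝓞 K) p by simp, Algebra.norm_algebraMap] at this
    exact hpI.not_isUnit ((isUnit_pow_iff Module.finrank_pos.ne').1 this)
  obtain ⟨P, hP, hpP⟩ := exists_max_ideal_of_mem_nonunits hu
  have hpr : P.IsPrime := hP.isPrime
  have hun := (not_dvd_discr_iff_forall_mem K (𝓞 K) hpI).1 hd P hpr hpP
  have hlies : P.LiesOver (Ideal.span {(p : ℤ)}) :=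
    (Ideal.liesOver_span_iff hpr.ne_top hpI).mpr hpP
  refine irreducible_cyclotomic_of_notMem_sq (R := 𝓞 K) hp hpr (by simpa using hpP) ?_ j
  intro hsq
  rw [← not_dvd_differentIdeal_iff] at hun
  apply hun
  have : (Ideal.span {(p : ℤ)}).IsMaximal :=
    PrincipalIdealRing.isMaximal_of_irreducible hpI.irreducible
  have := pow_sub_one_dvd_differentIdeal ℤ (p := Ideal.span {(p : ℤ)}) P 2
    (by simpa using hp.ne_zero) (by
      rw [Ideal.dvd_iff_le, Ideal.map_span, Set.image_singleton, Ideal.span_singleton_le_iff_mem]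
      simpa using hsq)
  simpa using this

/-- Adjoin `x = √a` and induct on `n` over `K(x)`. There `x` is again a non-square: its norm is
`-a`, and if that were a square so would be `a`, since `-1` is one. -/
theorem X_pow_two_pow_sub_C_irreducible {K : Type*} [Field K] (h1 : IsSquare (-1 : K)) {a : K}
    (ha : ¬ IsSquare a) (n : ℕ) : Irreducible (X ^ 2 ^ n - C a) := by
  have hp : Irreducible (X ^ 2 - C a) := by
    refine X_pow_sub_C_irreducible_of_prime Nat.prime_two fun b hb => ha ⟨b, ?_⟩
    rw [← hb, sq]
  induction n generalizing K a with
  | zero => simpa using irreducible_X_sub_C a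
  | succ n ih =>
    rw [pow_succ]
    refine X_pow_mul_sub_C_irreducible hp fun E _ _ x hx => ?_
    -- The minimal polynomial of a non-integral element is `0` by default, but here it has degree
    -- `2`.
    have hint : IsIntegral K x := not_not.mp fun h => by
      simpa only [degree_zero, degree_X_pow_sub_C two_pos,
        WithBot.natCast_ne_bot] using congr_arg degree (hx.symm.trans (dif_neg h))
    have hns : ¬ IsSquare (AdjoinSimple.gen K x) := by
      rintro ⟨b, hb⟩
      apply ha
      have hN := congrArg (Algebra.norm K) hb
      rw [map_mul, ← adjoin.powerBasis_gen hint,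
        Algebra.PowerBasis.norm_gen_eq_coeff_zero_minpoly] at hN
      have hN' : -a = Algebra.norm K b * Algebra.norm K b := by
        simpa [minpoly_gen, hx] using hN
      have : a = -1 * (Algebra.norm K b * Algebra.norm K b) := by rw [← hN']; ring
      rw [this]
      exact h1.mul ⟨_, rfl⟩
    refine ih (by simpa using h1.map (algebraMap K K⟮x⟯)) hns ?_
    refine X_pow_sub_C_irreducible_of_prime Nat.prime_two fun b hb => hns ⟨b, ?_⟩
    rw [← hb, sq]

/-- Since `Φ_{2^(j+2)} = X^{2^(j+1)} + 1`, it suffices that `X^{2^j} - i` is irreducible over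
`K(i)`, that is, that `i` is not a square there. From `(u + v i)² = i` follow `2uv = 1` and `v = ±
u`, so `(2u)² = ± 2`. -/
theorem irreducible_cyclotomic_two_pow (h1 : ¬ IsSquare (-1 : K)) (h2 : ¬ IsSquare (2 : K))
    (h2' : ¬ IsSquare (-2 : K)) (j : ℕ) : Irreducible (cyclotomic (2 ^ j) K) := by
  match j with
  | 0 => simpa using irreducible_X_sub_C (1 : K)
  | 1 =>
    rw [pow_one, cyclotomic_two]
    simpa using irreducible_X_sub_C (-1 : K)
  | j + 2 =>
    have hX : cyclotomic (2 ^ (j + 2)) K = X ^ (2 ^ j * 2) - C (-1) := by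
      rw [show j + 2 = (j + 1) + 1 by rfl, cyclotomic_prime_pow_eq_geom_sum Nat.prime_two]
      simp [Finset.sum_range_succ, pow_succ, add_comm]
    rw [hX]
    have hirr : Irreducible (X ^ 2 - C (-1) : K[X]) :=
      X_pow_sub_C_irreducible_of_prime Nat.prime_two fun b hb => h1 ⟨b, by rw [← hb, sq]⟩
    refine X_pow_mul_sub_C_irreducible hirr fun E _ _ x hx => ?_
    have hint : IsIntegral K x := not_not.mp fun h => by
      simpa only [degree_zero, degree_X_pow_sub_C two_pos,
        WithBot.natCast_ne_bot] using congr_arg degree (hx.symm.trans (dif_neg h))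
    set i := AdjoinSimple.gen K x with hi
    have hi2 : i ^ 2 = -1 := by
      have := minpoly.aeval K i
      rw [minpoly_gen, hx] at this
      simp only [map_sub, map_pow, aeval_X, map_neg, map_one] at this
      linear_combination this
    have hnK : ∀ c : K, algebraMap K K⟮x⟯ c ≠ i := fun c hc => by
      rw [← hc, ← map_pow] at hi2
      refine h1 ⟨c, ?_⟩
      rw [← sq]
      exact ((algebraMap K K⟮x⟯).injective (by rw [hi2]; simp)).symm
    refine X_pow_two_pow_sub_C_irreducible ⟨i, by rw [← sq, hi2]⟩ ?_ j
    rintro ⟨b, hb⟩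
    obtain ⟨f, hf, hbf⟩ := (adjoin.powerBasis hint).exists_eq_aeval b
    rw [adjoin.powerBasis_dim, hx, natDegree_X_pow_sub_C] at hf
    obtain ⟨v, u, rfl⟩ := exists_eq_X_add_C_of_natDegree_le_one (Nat.lt_succ_iff.1 hf)
    rw [adjoin.powerBasis_gen] at hbf
    simp only [map_add, map_mul, aeval_C, aeval_X, ← hi] at hbf
    set A := algebraMap K K⟮x⟯
    have h3 : A (2 * u * v - 1) * i = A (v ^ 2 - u ^ 2) := by
      simp only [map_sub, map_mul, map_pow, map_one, map_ofNat]
      rw [hbf] at hb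
      linear_combination -hb - A v ^ 2 * hi2
    have h4 : 2 * u * v - 1 = 0 := by
      by_contra h
      have h5 : A (2 * u * v - 1) ≠ 0 := (map_ne_zero A).2 h
      refine hnK ((v ^ 2 - u ^ 2) / (2 * u * v - 1)) ?_
      rw [map_div₀, ← h3]
      field_simp
    rw [h4, map_zero, zero_mul] at h3
    have h5 : v ^ 2 - u ^ 2 = 0 := (map_eq_zero A).1 h3.symm
    have h6 : (v - u) * (v + u) = 0 := by linear_combination h5
    rcases mul_eq_zero.1 h6 with h | h
    · exact h2 ⟨2 * u, by linear_combination -2 * h4 + 4 * u * h⟩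
    · exact h2' ⟨2 * u, by linear_combination 2 * h4 - 4 * u * h⟩

end IrreducibleCyclotomic

/-! ### Quadratic fields: where irreducibility fails. -/

section Quadratic

open Polynomial IntermediateField

/-- The witness is the quadratic Gauss sum, whose square is the quadratic character of `-1` times
`p`. -/
theorem exists_sq_eq_prime_of_isPrimitiveRoot {L : Type*} [Field L] [CharZero L] {p : ℕ}
    (hp : p.Prime) (hp2 : p ≠ 2) {ζ : L} (hζ : IsPrimitiveRoot ζ p) :
    ∃ y : L, y ^ 2 = ((ZMod.χ₄ (p : ZMod 4) * p : ℤ) : L) := by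
  have := Fact.mk hp
  have hchar : ringChar (ZMod p) ≠ 2 := by rwa [ZMod.ringChar_zmod_n]
  let χ := (quadraticChar (ZMod p)).ringHomComp (Int.castRingHom L)
  have hχ : χ ≠ 1 := (MulChar.ringHomComp_ne_one_iff (RingHom.injective_int _)).2
    (quadraticChar_ne_one hchar)
  refine ⟨gaussSum χ (AddChar.zmodChar p hζ.pow_eq_one), ?_⟩
  rw [gaussSum_sq hχ ((quadraticChar_isQuadratic (ZMod p)).comp _)
    (AddChar.zmodChar_primitive_of_primitive_root p hζ), MulChar.ringHomComp_apply,
    quadraticChar_neg_one hchar, ZMod.card]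
  simp

variable {K : Type*} [Field K] [NumberField K]

theorem exists_generator_sq_mem_range (hK : Module.finrank ℚ K = 2) :
    ∃ (x : K) (d : ℚ), x ^ 2 = algebraMap ℚ K d ∧ ℚ⟮x⟯ = ⊤ := by
  have : Algebra.IsQuadraticExtension ℚ K := ⟨hK⟩
  have hcard : Nat.card Gal(K/ℚ) = 2 := by rw [IsGalois.card_aut_eq_finrank, hK]
  have := isCyclic_of_prime_card (p := 2) hcard
  obtain ⟨x, ⟨d, hd⟩, hx⟩ := exists_root_adjoin_eq_top_of_isCyclic (K := ℚ) (L := K)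
    ⟨-1, by
      rw [hK, mem_primitiveRoots two_pos]
      exact IsPrimitiveRoot.neg_one 0 (by norm_num)⟩
  exact ⟨x, d, by rw [hd, hK], hx⟩

theorem adjoin_eq_top_of_finrank_eq_two (hK : Module.finrank ℚ K = 2) {x : K}
    (hx : x ∉ (⊥ : IntermediateField ℚ K)) : ℚ⟮x⟯ = ⊤ := by
  have hmul := Module.finrank_mul_finrank ℚ ℚ⟮x⟯ K
  rw [hK] at hmul
  have hne : Module.finrank ℚ ℚ⟮x⟯ ≠ 1 := fun h => hx (by
    rw [IntermediateField.finrank_eq_one_iff] at h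
    exact h ▸ mem_adjoin_simple_self ℚ x)
  have hdvd : Module.finrank ℚ ℚ⟮x⟯ ∣ 2 := ⟨_, hmul.symm⟩
  have h2 := ((Nat.dvd_prime Nat.prime_two).1 hdvd).resolve_left hne
  rw [h2] at hmul
  exact IntermediateField.finrank_eq_one_iff_eq_top.1 (by omega)

theorem notMem_bot_of_sq_eq_prime {p : ℕ} (hp : p.Prime) {x : K} (hx : x ^ 2 = p) :
    x ∉ (⊥ : IntermediateField ℚ K) := by
  rintro ⟨q, rfl⟩
  have h : q ^ 2 = p := by
    have : algebraMap ℚ K (q ^ 2) = algebraMap ℚ K p := by rw [map_pow, map_natCast]; exact hx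
    exact (algebraMap ℚ K).injective this
  have hirr := hp.irrational_sqrt
  apply hirr
  refine ⟨|q|, ?_⟩
  have h' : ((|q| : ℚ) : ℝ) ^ 2 = p := by
    rw [← Rat.cast_pow, sq_abs, h, Rat.cast_natCast]
  rw [← h', Real.sqrt_sq (by positivity)]

theorem isRationalsAdjoinSqrt_of_sq_eq (hK : Module.finrank ℚ K = 2) {p : ℕ} (hp : p.Prime) {x : K}
    (hx : x ^ 2 = p) : IsRationalsAdjoinSqrt K p :=
  ⟨x, hx, adjoin_eq_top_of_finrank_eq_two hK (notMem_bot_of_sq_eq_prime hp hx)⟩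

theorem exists_eq_algebraMap_mul_add (hK : Module.finrank ℚ K = 2) {x : K} (hx : ℚ⟮x⟯ = ⊤)
    (t : K) : ∃ v w : ℚ, t = algebraMap ℚ K w * x + algebraMap ℚ K v := by
  have hint : IsIntegral ℚ x := .of_finite ℚ x
  have hmem : t ∈ ℚ⟮x⟯ := hx ▸ IntermediateField.mem_top
  obtain ⟨f, hf, hbf⟩ := (adjoin.powerBasis hint).exists_eq_aeval ⟨t, hmem⟩
  rw [← (adjoin.powerBasis hint).finrank, hx, IntermediateField.finrank_top', hK] at hf
  obtain ⟨w, v, rfl⟩ := exists_eq_X_add_C_of_natDegree_le_one (Nat.lt_succ_iff.1 hf)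
  refine ⟨v, w, ?_⟩
  have := congrArg (algebraMap ℚ⟮x⟯ K) hbf
  simpa [adjoin.powerBasis_gen] using this

/-- A quadratic field contains a square root of at most one prime number. -/
theorem IsRationalsAdjoinSqrt.eq_of_prime (hK : Module.finrank ℚ K = 2) {p q : ℕ} (hp : p.Prime)
    (hq : q.Prime) (hKp : IsRationalsAdjoinSqrt K p) (hKq : IsRationalsAdjoinSqrt K q) :
    p = q := by
  obtain ⟨x, hx, hx'⟩ := hKp
  obtain ⟨y, hy, -⟩ := hKq
  obtain ⟨a, b, rfl⟩ := exists_eq_algebraMap_mul_add hK hx' y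
  set A := algebraMap ℚ K
  -- Squaring `y = b x + a` gives `q = a² + b² p + 2ab x`, so `ab = 0` because `x` is irrational. If
  -- `a = 0`, then `pq = (bp)²` forces `p = q`; if `b = 0`, then `√q` would be rational.
  have h1 : A (2 * a * b) * x = A (q - a ^ 2 - b ^ 2 * p) := by
    simp only [map_sub, map_mul, map_pow, map_natCast, map_ofNat]
    linear_combination hy - A b ^ 2 * hx
  have h2 : 2 * a * b = 0 := by
    by_contra hne
    have hA : A (2 * a * b) ≠ 0 := (map_ne_zero A).2 hne
    refine notMem_bot_of_sq_eq_prime hp hx ⟨(q - a ^ 2 - b ^ 2 * p) / (2 * a * b), ?_⟩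
    change A _ = x
    rw [map_div₀, ← h1]
    field_simp
  rw [h2, map_zero, zero_mul] at h1
  have h3 : (q : ℚ) - a ^ 2 - b ^ 2 * p = 0 := (map_eq_zero A).1 h1.symm
  rcases mul_eq_zero.1 h2 with h | h
  · have ha : a = 0 := by linarith
    have hsq : IsSquare ((p * q : ℕ) : ℚ) := ⟨b * p, by
      rw [ha] at h3
      push_cast
      linear_combination (p : ℚ) * h3⟩
    rw [Rat.isSquare_natCast_iff] at hsq
    obtain ⟨c, hc⟩ := hsq
    have hpc : p ∣ c := by
      have : p ∣ c * c := hc ▸ dvd_mul_right p q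
      exact (hp.dvd_mul.1 this).elim id id
    obtain ⟨d, rfl⟩ := hpc
    have : q = p * (d * d) := Nat.eq_of_mul_eq_mul_left hp.pos (by rw [hc]; ring)
    exact (Nat.prime_dvd_prime_iff_eq hp hq).1 ⟨_, this⟩
  · refine absurd ?_ (notMem_bot_of_sq_eq_prime hq hy)
    rw [h, map_zero, zero_mul, zero_add]
    exact ⟨a, rfl⟩

/-- A quadratic field over which a cyclotomic polynomial of odd prime power conductor is reducible
is generated by the square root of `± p`. -/
theorem exists_sq_eq_of_not_irreducible_cyclotomic (hK : Module.finrank ℚ K = 2) {p : ℕ}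
    (hp : p.Prime) (hp2 : p ≠ 2) {j : ℕ} (hj : ¬ Irreducible (cyclotomic (p ^ j) K))
    (L : Type*) [Field L] [NumberField L] [Algebra K L] [IsCyclotomicExtension {p ^ j} K L] :
    ∃ y : K, y ^ 2 = ((ZMod.χ₄ (p : ZMod 4) * p : ℤ) : K) := by
  have hj0 : j ≠ 0 := by
    rintro rfl
    exact hj (by simpa using irreducible_X_sub_C (1 : K))
  set n := p ^ j with hn
  have : NeZero n := ⟨(pow_pos hp.pos j).ne'⟩
  have hζ := IsCyclotomicExtension.zeta_spec n K L
  set ζ := IsCyclotomicExtension.zeta n K L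
  have hint : IsIntegral K ζ := .of_finite K ζ
  have hmp : minpoly K ζ ∣ cyclotomic n K := minpoly.dvd _ _ (by
    rw [aeval_def, eval₂_eq_eval_map, map_cyclotomic]
    exact (isRoot_cyclotomic_iff (n := n)).2 hζ)
  have hKL : Module.finrank K L = (minpoly K ζ).natDegree := by
    rw [(hζ.powerBasis K).finrank, ← (hζ.powerBasis K).natDegree_minpoly, hζ.powerBasis_gen K]
  have hlt : Module.finrank K L < n.totient := by
    rw [hKL]
    refine lt_of_le_of_ne ?_ fun h => hj ?_
    · rw [← natDegree_cyclotomic n K]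
      exact natDegree_le_of_dvd hmp (cyclotomic_ne_zero n K)
    · have := eq_of_monic_of_dvd_of_natDegree_le (minpoly.monic hint) (cyclotomic.monic n K) hmp
        (by rw [natDegree_cyclotomic, h])
      rw [this]
      exact minpoly.irreducible hint
  have hEφ : Module.finrank ℚ ℚ⟮ζ⟯ = n.totient := by
    rw [adjoin.finrank (.of_finite ℚ ζ), ← cyclotomic_eq_minpoly_rat hζ (NeZero.pos n),
      natDegree_cyclotomic]
  have h1 := Module.finrank_mul_finrank ℚ ℚ⟮ζ⟯ L
  have h2 := Module.finrank_mul_finrank ℚ K L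
  rw [hK] at h2
  rw [hEφ, ← h2] at h1
  have hφ : 0 < n.totient := Nat.totient_pos.2 (NeZero.pos n)
  -- Reducibility gives `[L : K] < φ(n)`, hence `[L : ℚ] < 2 φ(n)`. As `[ℚ(ζ) : ℚ] = φ(n)`, this
  -- leaves `L = ℚ(ζ)`, so `K` lies in a cyclotomic field whose Galois group over `ℚ` is cyclic.
  have htop : ℚ⟮ζ⟯ = ⊤ := by
    rw [← IntermediateField.finrank_eq_one_iff_eq_top]
    have hpos : 0 < Module.finrank ℚ⟮ζ⟯ L := Module.finrank_pos
    by_contra hne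
    have : 2 ≤ Module.finrank ℚ⟮ζ⟯ L := by omega
    nlinarith
  have hL : IsCyclotomicExtension {n} ℚ L := by
    have hadj := adjoin_simple_toSubalgebra_of_isAlgebraic (F := ℚ)
      (Algebra.IsAlgebraic.isAlgebraic ζ)
    rw [htop, top_toSubalgebra] at hadj
    refine (IsCyclotomicExtension.iff_singleton n ℚ L).2 ⟨⟨ζ, hζ⟩, fun x => ?_⟩
    have hx : x ∈ Algebra.adjoin ℚ {ζ} := hadj ▸ Algebra.mem_top
    have hsub : ({ζ} : Set L) ⊆ {b : L | b ^ n = 1} := by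
      rintro _ rfl
      exact hζ.pow_eq_one
    exact (Algebra.adjoin_mono (R := ℚ) hsub : _ ≤ _) hx
  have := IsCyclotomicExtension.isGalois {n} ℚ L
  have := IsCyclotomicExtension.isGalois {n} K L
  have hcyc : IsCyclic Gal(L/ℚ) := by
    have := ZMod.isCyclic_units_of_prime_pow p hp hp2 j
    exact isCyclic_of_injective
      (IsCyclotomicExtension.autEquivPow L (cyclotomic.irreducible_rat (NeZero.pos n))).toMonoidHom
      (MulEquiv.injective _)
  obtain ⟨σ, hσ⟩ := hcyc.exists_generator
  obtain ⟨x, d, hxd, hx⟩ := exists_generator_sq_mem_range hK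
  have hxbot : x ∉ (⊥ : IntermediateField ℚ K) := fun h => by
    rw [← adjoin_simple_eq_bot_iff, hx] at h
    have := IntermediateField.finrank_top' (F := ℚ) (E := K)
    rw [h, IntermediateField.finrank_bot, hK] at this
    omega
  obtain ⟨ξ, hξ⟩ : ∃ ξ : L, IsPrimitiveRoot ξ p := by
    obtain ⟨i, rfl⟩ := Nat.exists_eq_succ_of_ne_zero hj0
    exact ⟨_, hζ.pow (NeZero.pos n) (by rw [hn, pow_succ])⟩
  obtain ⟨y, hy⟩ := exists_sq_eq_prime_of_isPrimitiveRoot hp hp2 hξ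
  have hsq : ∀ (z : L) (c : ℚ), z ^ 2 = algebraMap ℚ L c → ∀ τ : Gal(L/ℚ), (τ ^ 2) z = z := by
    intro z c hz τ
    have : (τ z) ^ 2 = z ^ 2 := by rw [← map_pow, hz, AlgEquiv.commutes]
    rcases sq_eq_sq_iff_eq_or_eq_neg.1 this with h | h <;> simp [sq, AlgEquiv.mul_apply, h, map_neg]
  have hx' : (algebraMap K L x) ^ 2 = algebraMap ℚ L d := by
    rw [← map_pow, hxd, ← IsScalarTower.algebraMap_apply]
  -- An element of `Gal(L/K)` is an even power of the generator `σ`: an odd power fixing `x` would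
  -- make `σ` fix `x`, and `x` would be rational. Even powers fix every square root of a rational,
  -- in particular the Gauss sum `y`.
  have hyK : y ∈ (⊥ : IntermediateField K L) := by
    rw [IsGalois.mem_bot_iff_fixed]
    intro τ
    obtain ⟨m, hm⟩ := Subgroup.mem_zpowers_iff.1 (hσ (τ.restrictScalars ℚ))
    have hmk : Even m := by
      by_contra hodd
      rw [Int.not_even_iff_odd] at hodd
      obtain ⟨k, rfl⟩ := hodd
      have hfix : σ (algebraMap K L x) = algebraMap K L x := by
        have h3 : (σ ^ (2 * k + 1)) (algebraMap K L x) = algebraMap K L x := by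
          rw [hm]; simp
        rw [add_comm, zpow_add, zpow_one, AlgEquiv.mul_apply, mul_comm 2 k, zpow_mul, zpow_ofNat,
          hsq _ d hx' (σ ^ k)] at h3
        exact h3
      have hall : ∀ ρ : Gal(L/ℚ), ρ (algebraMap K L x) = algebraMap K L x := fun ρ => by
        obtain ⟨k, rfl⟩ := Subgroup.mem_zpowers_iff.1 (hσ ρ)
        have hst : σ ∈ MulAction.stabilizer Gal(L/ℚ) (algebraMap K L x) := hfix
        exact Subgroup.zpow_mem _ hst k
      obtain ⟨q, hq⟩ := (IsGalois.mem_bot_iff_fixed _).2 hall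
      refine hxbot ⟨q, (algebraMap K L).injective ?_⟩
      rw [← hq]
      exact (IsScalarTower.algebraMap_apply ℚ K L q).symm
    obtain ⟨k, rfl⟩ := hmk
    have h4 := hsq y ((ZMod.χ₄ (p : ZMod 4) * p : ℤ) : ℚ) (by rw [hy, map_intCast]) (σ ^ k)
    rw [sq, ← zpow_add, hm] at h4
    simpa using h4
  obtain ⟨y', hy'⟩ := hyK
  refine ⟨y', (algebraMap K L).injective ?_⟩
  rw [map_pow]
  have : algebraMap K L y' = y := hy'
  rw [this, hy, map_intCast]

variable [IsTotallyReal K]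

variable (K) in
theorem IsTotallyReal.nonempty_ringHom_real : Nonempty (K →+* ℝ) := by
  obtain ⟨φ⟩ : Nonempty (K →+* ℂ) := inferInstance
  exact ⟨(IsTotallyReal.complexEmbedding_isReal φ).embedding⟩

theorem IsTotallyReal.not_isSquare_intCast_of_neg {c : ℤ} (hc : c < 0) : ¬ IsSquare (c : K) := by
  obtain ⟨φ⟩ := IsTotallyReal.nonempty_ringHom_real K
  rintro ⟨x, hx⟩
  have h := congrArg φ hx
  rw [map_intCast, map_mul] at h
  have : (c : ℝ) < 0 := by exact_mod_cast hc
  nlinarith [mul_self_nonneg (φ x)]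

/-- Reducibility puts `√p` or `√(-p)` in `K` according to `p` modulo `4`; a real embedding rules out
the second. -/
theorem irreducible_cyclotomic_odd_of_totallyReal (hK : Module.finrank ℚ K = 2) {p : ℕ}
    (hp : p.Prime) (hp2 : p ≠ 2) (h : p ≡ 1 [MOD 4] → ¬ IsRationalsAdjoinSqrt K p) (j : ℕ) :
    Irreducible (cyclotomic (p ^ j) K) := by
  by_contra hj
  have : NeZero (p ^ j) := ⟨(pow_pos hp.pos j).ne'⟩
  obtain ⟨y, hy⟩ := exists_sq_eq_of_not_irreducible_cyclotomic hK hp hp2 hj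
    (CyclotomicField (p ^ j) K)
  have hodd := (hp.eq_two_or_odd).resolve_left hp2
  rcases Nat.odd_mod_four_iff.1 hodd with h4 | h4
  · rw [ZMod.χ₄_nat_one_mod_four h4] at hy
    exact h h4 (isRationalsAdjoinSqrt_of_sq_eq hK hp (x := y) (by simpa using hy))
  · rw [ZMod.χ₄_nat_three_mod_four h4] at hy
    refine IsTotallyReal.not_isSquare_intCast_of_neg (K := K) (c := -1 * p) ?_ ⟨y, by
      rw [← hy, sq]⟩
    have := hp.pos
    omega

theorem irreducible_cyclotomic_two_pow_of_totallyReal (hK : Module.finrank ℚ K = 2)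
    (h : ¬ IsRationalsAdjoinSqrt K 2) (j : ℕ) : Irreducible (cyclotomic (2 ^ j) K) := by
  refine irreducible_cyclotomic_two_pow ?_ ?_ ?_ j
  · simpa using IsTotallyReal.not_isSquare_intCast_of_neg (K := K) (c := -1) (by norm_num)
  · rintro ⟨x, hx⟩
    exact h (isRationalsAdjoinSqrt_of_sq_eq hK Nat.prime_two (x := x) (by simp [sq, hx]))
  · simpa using IsTotallyReal.not_isSquare_intCast_of_neg (K := K) (c := -2) (by norm_num)

end Quadratic

/-! ### Restriction of scalars to a subfield. -/

section RestrictScalars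

variable {F K G V : Type*} [Field F] [Field K] [Algebra F K] [Group G]
  [AddCommGroup V] [Module K V] [Module F V] [IsScalarTower F K V]

theorem LinearMap.trace_restrictScalars [FiniteDimensional F K] [FiniteDimensional K V]
    (f : V →ₗ[K] V) :
    LinearMap.trace F V (f.restrictScalars F) = Algebra.trace F K (LinearMap.trace K V f) := by
  classical
  let bK := Module.finBasis F K
  let bV := Module.finBasis K V
  rw [LinearMap.trace_eq_matrix_trace F (bK.smulTower' bV), LinearMap.restrictScalars_toMatrix,
    LinearMap.trace_eq_matrix_trace K bV, Matrix.trace, Matrix.trace, map_sum,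
    Fintype.sum_prod_type]
  refine Finset.sum_congr rfl fun i _ => ?_
  rw [Algebra.trace_eq_matrix_trace bK, Matrix.trace]
  rfl

/-- A representation over `K` viewed as a representation over a subfield `F`. -/
def Representation.overSubfield (F : Type*) {K G V : Type*} [Field F] [Field K] [Algebra F K]
    [Group G] [AddCommGroup V] [Module K V] [Module F V] [IsScalarTower F K V]
    (ρ : Representation K G V) : Representation F G V where
  toFun g := (ρ g).restrictScalars F
  map_one' := by ext; simp
  map_mul' g h := by ext; simp

theorem Representation.overSubfield_injective (ρ : Representation K G V)
    (hρ : Function.Injective ρ) : Function.Injective (ρ.overSubfield F) := fun _ _ h =>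
  hρ (LinearMap.restrictScalars_injective F h)

end RestrictScalars

/-! ### Linear groups over a ring as representations over a field. -/

section MatrixRepresentation

variable {R K : Type*} [CommRing R] [Field K] [Algebra R K] {n : ℕ}

/-- The representation of a linear group over `R` on `Kⁿ`. -/
noncomputable def matrixRepresentation (K : Type*) {R : Type*} [CommRing R] [Field K] [Algebra R K]
    {n : ℕ} (G : Subgroup (GL (Fin n) R)) : Representation K G (Fin n → K) :=
  (Matrix.toLinAlgEquiv' : Matrix (Fin n) (Fin n) K ≃ₐ[K] _).toMonoidHom.comp
    (((algebraMap R K).mapMatrix.toMonoidHom.comp (Units.coeHom _)).comp G.subtype)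

theorem matrixRepresentation_apply (G : Subgroup (GL (Fin n) R)) (g : G) :
    matrixRepresentation K G g =
      Matrix.toLin' ((g : GL (Fin n) R).1.map (algebraMap R K)) := rfl

theorem matrixRepresentation_injective [FaithfulSMul R K] (G : Subgroup (GL (Fin n) R)) :
    Function.Injective (matrixRepresentation K G) := fun g h hgh => by
  rw [matrixRepresentation_apply, matrixRepresentation_apply] at hgh
  have h1 := Matrix.toLin'.injective hgh
  refine Subtype.ext (Units.ext ?_)
  ext i j
  exact FaithfulSMul.algebraMap_injective R K (congrFun (congrFun h1 i) j)

theorem character_matrixRepresentation (G : Subgroup (GL (Fin n) R)) (g : G) :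
    (matrixRepresentation K G).character g = algebraMap R K (g : GL (Fin n) R).1.trace := by
  rw [Representation.character, matrixRepresentation_apply, Matrix.trace_toLin'_eq,
    Matrix.trace, Matrix.trace, map_sum]
  rfl

end MatrixRepresentation

/-! ### The `p`-part of the order of a finite subgroup of `GL_n(𝓞 K)`. -/

section FiniteSubgroups

open Polynomial

variable {K : Type*} [Field K] [NumberField K] {n : ℕ}

/-- The bound for the order of a `p`-subgroup carries over to the `p`-part of the order of a finite
group. -/
theorem pow_factorization_card_dvd {H : Type*} [Group H] {G : Subgroup H} [Finite G] {p c : ℕ}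
    (hp : p.Prime)
    (h : ∀ P : Subgroup H, Finite P → IsPGroup p P → Nat.card P ∣ c) :
    p ^ (Nat.card G).factorization p ∣ c := by
  have := Fact.mk hp
  obtain ⟨P⟩ : Nonempty (Sylow p G) := inferInstance
  rw [← P.card_eq_multiplicity]
  have e := P.1.equivMapOfInjective G.subtype G.subtype_injective
  have := Finite.of_equiv _ e.toEquiv
  rw [Nat.card_congr e.toEquiv]
  exact h _ this (P.isPGroup'.of_equiv e)

theorem pow_factorization_card_dvd_of_irreducible {p : ℕ} (hp : p.Prime)
    (hirr : ∀ j, Irreducible (cyclotomic (p ^ j) K)) (G : Subgroup (GL (Fin n) (𝓞 K))) [Finite G] :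
    p ^ (Nat.card G).factorization p ∣ p ^ (n / (p - 1)) * (n / (p - 1)).factorial := by
  refine pow_factorization_card_dvd hp fun P _ hP => ?_
  simpa using Representation.card_dvd_of_isPGroup hp hirr hP (matrixRepresentation K P)
    (matrixRepresentation_injective P)

theorem irreducible_cyclotomic_prime_pow_rat {p : ℕ} (hp : p.Prime) (j : ℕ) :
    Irreducible (cyclotomic (p ^ j) ℚ) :=
  cyclotomic.irreducible_rat (pow_pos hp.pos j)

theorem pow_factorization_card_dvd_of_finrank {p : ℕ} (hp : p.Prime)
    (G : Subgroup (GL (Fin n) (𝓞 K))) [Finite G] :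
    p ^ (Nat.card G).factorization p ∣ p ^ (n * Module.finrank ℚ K / (p - 1)) *
      (n * Module.finrank ℚ K / (p - 1)).factorial := by
  refine pow_factorization_card_dvd hp fun P _ hP => ?_
  simpa [Module.finrank_pi_fintype] using
    Representation.card_dvd_of_isPGroup hp (irreducible_cyclotomic_prime_pow_rat hp) hP
    ((matrixRepresentation K P).overSubfield ℚ)
    (Representation.overSubfield_injective _ (matrixRepresentation_injective P))

/-- Over the residue field with `q` elements `tr (B ^ q) = (tr B) ^ q = tr B`, so `tr B = tr (B ^ q
^ k)`. The latter is `tr 1 = n`, because `p ^ k` divides `q ^ k`. -/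
theorem Matrix.trace_sub_natCast_mem {R : Type*} [CommRing R] {p : ℕ} (hp : p.Prime) (P : Ideal R)
    [P.IsMaximal] [Finite (R ⧸ P)] (hpP : (p : R) ∈ P) {k : ℕ} {A : Matrix (Fin n) (Fin n) R}
    (hA : A ^ p ^ k = 1) : A.trace - n ∈ P := by
  have := Fact.mk hp
  let := Ideal.Quotient.field P
  have := Fintype.ofFinite (R ⧸ P)
  have hchar : CharP (R ⧸ P) p := (CharP.charP_iff_prime_eq_zero hp).2 (by
    rw [← map_natCast (Ideal.Quotient.mk P), Ideal.Quotient.eq_zero_iff_mem]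
    exact hpP)
  obtain ⟨f, -, hf⟩ := FiniteField.card (R ⧸ P) p
  let B := A.map (Ideal.Quotient.mk P)
  have htr : ∀ m : ℕ, (B ^ (Fintype.card (R ⧸ P)) ^ m).trace = B.trace := fun m => by
    induction m with
    | zero => simp
    | succ m ih => rw [pow_succ, pow_mul, FiniteField.trace_pow_card, ih, FiniteField.pow_card]
  have hB : B ^ p ^ k = 1 := by
    have := congrArg (Ideal.Quotient.mk P).mapMatrix hA
    rwa [map_pow, map_one] at this
  have h1 : B ^ (Fintype.card (R ⧸ P)) ^ k = 1 := by
    obtain ⟨c, hc⟩ : p ^ k ∣ (Fintype.card (R ⧸ P)) ^ k := by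
      rw [hf]
      exact pow_dvd_pow_of_dvd (dvd_pow_self p f.ne_zero) k
    rw [hc, pow_mul, hB, one_pow]
  have h2 := htr k
  rw [h1, Matrix.trace_one, Fintype.card_fin] at h2
  rw [← Ideal.Quotient.eq_zero_iff_mem, map_sub, map_natCast, h2, sub_eq_zero, Matrix.trace,
    Matrix.trace, map_sum]
  rfl

end FiniteSubgroups

/-! ### The `2`-part over `ℚ(√2)`. -/

section SqrtTwo

open IntermediateField Polynomial

variable {K : Type*} [Field K] [NumberField K]

theorem trace_eq_zero_of_sq_eq_two (hK : Module.finrank ℚ K = 2) {x : K} (hx2 : x ^ 2 = 2)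
    (hx : ℚ⟮x⟯ = ⊤) : Algebra.trace ℚ K x = 0 := by
  have hint : IsIntegral ℚ x := .of_finite ℚ x
  have hdeg : (minpoly ℚ x).natDegree = 2 := by
    rw [← adjoin.finrank hint, hx, IntermediateField.finrank_top', hK]
  have hmp : minpoly ℚ x = X ^ 2 - C 2 :=
    (eq_of_monic_of_dvd_of_natDegree_le (minpoly.monic hint) (monic_X_pow_sub_C 2 two_ne_zero)
      (minpoly.dvd _ _ (by simp [hx2])) (by rw [hdeg, natDegree_X_pow_sub_C])).symm
  rw [trace_eq_finrank_mul_minpoly_nextCoeff, hmp, nextCoeff_of_natDegree_pos (by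
    rw [natDegree_X_pow_sub_C]; exact two_pos), natDegree_X_pow_sub_C]
  simp

/-- Write `t = u + w √2`. Integrality of `(t - u)² = 2w²` forces `w` to be an integer `c`, so `(t -
u)² = 2c²` lies in `P`. Then `t - u` and `u - n` lie in `P`, and an integer in `P` is even. -/
theorem even_sub_of_trace_eq (hK : Module.finrank ℚ K = 2) {x : K} (hx2 : x ^ 2 = 2)
    (hx : ℚ⟮x⟯ = ⊤) {P : Ideal (𝓞 K)} [P.IsPrime] (hP : (2 : 𝓞 K) ∈ P) {t : 𝓞 K} {n : ℤ}
    (htn : t - n ∈ P) {u : ℤ} (htr : Algebra.trace ℚ K t = 2 * u) : Even (u - n) := by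
  obtain ⟨v, w, ht⟩ := exists_eq_algebraMap_mul_add hK hx (t : K)
  have hv : v = u := by
    rw [ht, map_add, Algebra.trace_algebraMap, hK, ← Algebra.smul_def, map_smul,
      trace_eq_zero_of_sq_eq_two hK hx2 hx] at htr
    simp only [smul_zero, zero_add, nsmul_eq_mul, Nat.cast_ofNat] at htr
    linarith
  subst hv
  have hy : algebraMap (𝓞 K) K (t - (u : 𝓞 K)) = algebraMap ℚ K w * x := by
    have ht' : algebraMap (𝓞 K) K t = algebraMap ℚ K w * x + algebraMap ℚ K u := ht
    rw [map_sub, ht']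
    simp
  have hsq : algebraMap (𝓞 K) K ((t - (u : 𝓞 K)) ^ 2) = algebraMap ℚ K (2 * w ^ 2) := by
    rw [map_pow, hy, mul_pow, hx2]
    simp [mul_comm]
  obtain ⟨m, hm⟩ : ∃ m : ℤ, algebraMap ℤ ℚ m = 2 * w ^ 2 := by
    rw [← IsIntegrallyClosed.isIntegral_iff,
      ← isIntegral_algebraMap_iff (algebraMap ℚ K).injective, ← hsq]
    exact RingOfIntegers.isIntegral_coe _
  obtain ⟨a, ha⟩ : ∃ a : ℤ, algebraMap ℤ ℚ a = 2 * w := by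
    rw [← IsIntegrallyClosed.isIntegral_iff]
    refine IsIntegral.of_pow two_pos ?_
    rw [show (2 * w) ^ 2 = algebraMap ℤ ℚ (2 * m) by rw [map_mul, hm]; simp; ring]
    exact isIntegral_algebraMap
  have ham : a ^ 2 = 2 * m := by
    have : ((a ^ 2 : ℤ) : ℚ) = (2 * m : ℤ) := by
      simp only [eq_intCast] at ha hm
      push_cast
      rw [ha, hm]
      ring
    exact_mod_cast this
  obtain ⟨c, rfl⟩ : Even a := by
    rw [← Int.even_pow' two_ne_zero, ham]
    exact even_two_mul m
  have hm2 : m = 2 * c ^ 2 := by nlinarith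
  have hyP : t - (u : 𝓞 K) ∈ P := by
    have : (t - (u : 𝓞 K)) ^ 2 = 2 * (c ^ 2 : ℤ) := by
      apply RingOfIntegers.coe_injective
      rw [hsq, ← hm, hm2, map_mul (algebraMap (𝓞 K) K), map_intCast (algebraMap (𝓞 K) K),
        map_ofNat (algebraMap (𝓞 K) K) 2]
      simp
    exact ‹P.IsPrime›.mem_of_pow_mem 2 (this ▸ P.mul_mem_right _ hP)
  have huP : ((u - n : ℤ) : 𝓞 K) ∈ P := by
    have := P.sub_mem htn hyP
    push_cast
    convert this using 1
    ring
  by_contra hodd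
  obtain ⟨r, hr⟩ := Int.not_even_iff_odd.1 hodd
  rw [hr] at huP
  have h1 : (1 : 𝓞 K) ∈ P := by
    have := P.sub_mem huP (P.mul_mem_right (r : 𝓞 K) hP)
    push_cast at this
    simpa using this
  exact ‹P.IsPrime›.ne_top ((Ideal.eq_top_iff_one P).2 h1)

/-- Over `ℚ` the dimension is `2n` and the character is `2n - 2b` with `b ≤ 2n`. It is also the
trace from `K` to `ℚ` of the matrix trace, which is congruent to `n` modulo a prime above `2`; this
makes `b` even. The values off the identity are thus `2n - 4c` with `1 ≤ c ≤ n`, giving `4 ^ n * n!`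
instead of `4 ^ n * (2n)!`. -/
theorem pow_factorization_two_card_dvd (hK : Module.finrank ℚ K = 2)
    (h2 : IsRationalsAdjoinSqrt K 2) {n : ℕ} (G : Subgroup (GL (Fin n) (𝓞 K))) [Finite G] :
    2 ^ (Nat.card G).factorization 2 ∣ 4 ^ n * n.factorial := by
  obtain ⟨x, hx2, hx⟩ := h2
  rw [Nat.cast_ofNat] at hx2
  refine pow_factorization_card_dvd Nat.prime_two fun P _ hP => ?_
  have := Fintype.ofFinite P
  have hu : ¬ IsUnit (2 : 𝓞 K) := by
    intro h
    have := h.map (Algebra.norm ℤ)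
    rw [show (2 : 𝓞 K) = algebraMap ℤ (𝓞 K) 2 by simp, Algebra.norm_algebraMap] at this
    exact Int.prime_two.not_isUnit ((isUnit_pow_iff Module.finrank_pos.ne').1 this)
  obtain ⟨Q, hQ, hQ2⟩ := exists_max_ideal_of_mem_nonunits hu
  have hQ0 : Q ≠ ⊥ := by
    rintro rfl
    exact two_ne_zero ((Ideal.mem_bot).1 hQ2)
  have : Finite (𝓞 K ⧸ Q) := Ideal.finiteQuotientOfFreeOfNeBot Q hQ0
  let ρ := (matrixRepresentation K P).overSubfield ℚ
  have hρ : Function.Injective ρ :=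
    Representation.overSubfield_injective _ (matrixRepresentation_injective P)
  have hdim : Module.finrank ℚ (Fin n → K) = 2 * n := by
    simp [Module.finrank_pi_fintype, hK, mul_comm]
  have key : ∀ g : P, ∃ b : ℕ, ρ.character g = ((2 * n - 4 * b : ℤ) : ℚ) ∧ b ≤ n ∧
      (b = 0 → g = 1) := fun g => by
    obtain ⟨k, hk⟩ := hP g
    obtain ⟨b, h1, h2, h3⟩ := LinearMap.exists_trace_eq_of_pow_eq_one Nat.prime_two
      (irreducible_cyclotomic_prime_pow_rat Nat.prime_two) (f := ρ g) (k := k)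
      (by rw [← map_pow, hk, map_one])
    rw [hdim] at h1 h2
    have hA : (g : GL (Fin n) (𝓞 K)).1 ^ 2 ^ k = 1 := by
      rw [← Units.val_pow_eq_pow_val, ← Subgroup.coe_pow, hk]
      simp
    have hmem := Matrix.trace_sub_natCast_mem Nat.prime_two Q (by simpa using hQ2) hA
    have htr : Algebra.trace ℚ K ((g : GL (Fin n) (𝓞 K)).1.trace : 𝓞 K) = 2 * (n - b : ℤ) := by
      have h4 : LinearMap.trace ℚ (Fin n → K) (ρ g) =
          Algebra.trace ℚ K ((matrixRepresentation K P).character g) :=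
        LinearMap.trace_restrictScalars _
      rw [character_matrixRepresentation] at h4
      rw [← h4, h1]
      push_cast
      ring
    have heven := even_sub_of_trace_eq hK hx2 hx hQ2 (n := n) (by simpa using hmem) htr
    have hb : Even b := by
      rw [← Int.even_coe_nat]
      have h6 : (n - b : ℤ) - n = -b := by ring
      rw [h6] at heven
      simpa using heven
    obtain ⟨c, rfl⟩ := hb
    refine ⟨c, ?_, by omega, fun h0 => hρ ?_⟩
    · rw [Representation.character, h1]
      push_cast
      ring
    · rw [h3 (by omega), map_one]
  choose b hb1 hb2 hb3 using key
  have hinj : Set.InjOn (fun j : ℕ => (2 * n : ℤ) - 4 * (j + 1 : ℕ)) (Finset.range n) :=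
    fun i _ j _ h => by
      have h' : (2 * n : ℤ) - 4 * (i + 1 : ℕ) = 2 * n - 4 * (j + 1 : ℕ) := h
      omega
  have h := ρ.card_dvd_prod_finrank_sub _ hb1
    ((Finset.range n).image fun j : ℕ => (2 * n : ℤ) - 4 * (j + 1 : ℕ)) ?_
  · rw [Finset.prod_image hinj, hdim] at h
    push_cast at h
    simp only [sub_sub_cancel] at h
    rw [Finset.prod_mul_distrib, Finset.prod_const, Finset.card_range] at h
    rw [← Finset.prod_range_add_one_eq_factorial]
    exact_mod_cast h
  · intro g hg
    have h0 : b g ≠ 0 := fun h => hg (hb3 g h)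
    have := hb2 g
    exact Finset.mem_image.2 ⟨b g - 1, Finset.mem_range.2 (by omega), by
      rw [Nat.sub_add_cancel (Nat.pos_of_ne_zero h0)]⟩

end SqrtTwo

/-! ### Digit sums and the comparison of `∑ ⌊n / (p - 1)⌋ log p` with `log n!`. -/

section DigitSums

/-- This is Legendre's formula `n = s_p(n) + (p - 1) v_p(n!)`, with `s_p` the digit sum, divided by
`p - 1`. The digit term is the whole error in the comparison with `log n!`. -/
theorem div_sub_one_eq_factorization_factorial_add {p : ℕ} (hp : p.Prime) (n : ℕ) :
    n / (p - 1) = n.factorial.factorization p + (p.digits n).sum / (p - 1) := by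
  have := Fact.mk hp
  have hp1 : 0 < p - 1 := Nat.sub_pos_of_lt hp.one_lt
  have h := sub_one_mul_padicValNat_factorial (p := p) n
  have hle := Nat.digit_sum_le p n
  rw [Nat.factorization_def _ hp]
  conv_lhs => rw [show n = (p.digits n).sum + (p - 1) * padicValNat p n.factorial by omega]
  rw [Nat.add_mul_div_left _ _ hp1, add_comm]

theorem factorization_factorial_le_div {p : ℕ} (hp : p.Prime) (n : ℕ) :
    (n.factorial.factorization p : ℝ) ≤ n / (p - 1) := by
  have := Fact.mk hp
  have hp1 : (0 : ℝ) < p - 1 := by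
    have : (1 : ℝ) < p := by exact_mod_cast hp.one_lt
    linarith
  rw [le_div_iff₀ hp1, Nat.factorization_def _ hp, mul_comm]
  have h : (p - 1) * padicValNat p n.factorial ≤ n := by
    rw [sub_one_mul_padicValNat_factorial]
    exact Nat.sub_le _ _
  have h' : (((p - 1) * padicValNat p n.factorial : ℕ) : ℝ) ≤ n := by exact_mod_cast h
  rwa [Nat.cast_mul, Nat.cast_sub hp.one_lt.le, Nat.cast_one] at h'

theorem digits_sum_div_sub_one_mul_log_le {p n : ℕ} (hp : p.Prime) (hn : 1 ≤ n) (hpn : p ≤ n) :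
    (((p.digits n).sum / (p - 1) : ℕ) : ℝ) * Real.log p ≤ 2 * Real.log n := by
  have hp1 : 0 < p - 1 := Nat.sub_pos_of_lt hp.one_lt
  have hlen : (p.digits n).length = Nat.log p n + 1 := Nat.length_digits p n hp.one_lt (by omega)
  have hsum : (p.digits n).sum ≤ (Nat.log p n + 1) * (p - 1) := by
    rw [← hlen, ← smul_eq_mul]
    exact List.sum_le_card_nsmul _ _ fun d hd => by
      have := Nat.digits_lt_base hp.one_lt hd
      omega
  have hdiv : (p.digits n).sum / (p - 1) ≤ Nat.log p n + 1 := Nat.div_le_of_le_mul (by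
    rwa [mul_comm] at hsum)
  have hp0 : (0 : ℝ) < p := by exact_mod_cast hp.pos
  have hlogp : 0 ≤ Real.log p := Real.log_natCast_nonneg p
  have hlog : (Nat.log p n : ℝ) * Real.log p ≤ Real.log n := by
    rw [← Real.log_pow]
    refine Real.log_le_log (by positivity) ?_
    exact_mod_cast Nat.pow_log_le_self p (by omega)
  have hlog' : Real.log p ≤ Real.log n := Real.log_le_log hp0 (by exact_mod_cast hpn)
  have hdiv' : (((p.digits n).sum / (p - 1) : ℕ) : ℝ) ≤ Nat.log p n + 1 := by exact_mod_cast hdiv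
  nlinarith

theorem digits_sum_of_lt_sq {p n : ℕ} (hp : p.Prime) (h : n < p ^ 2) :
    (p.digits n).sum = n % p + n / p := by
  rcases Nat.eq_zero_or_pos n with rfl | hn
  · simp
  rw [Nat.digits_def' hp.one_lt hn]
  have hlt : n / p < p := Nat.div_lt_of_lt_mul (by rwa [← sq])
  rcases Nat.eq_zero_or_pos (n / p) with h0 | h0
  · simp [h0]
  · rw [Nat.digits_of_lt p _ h0.ne' hlt]
    simp

theorem digits_sum_div_le_two {p n : ℕ} (hp : p.Prime) (h : n < p ^ 2) :
    (p.digits n).sum / (p - 1) ≤ 2 := by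
  have h1 : n % p < p := Nat.mod_lt _ hp.pos
  have h2 : n / p < p := Nat.div_lt_of_lt_mul (by rwa [← sq])
  rw [digits_sum_of_lt_sq hp h]
  exact Nat.div_le_of_le_mul (by omega)

/-- The primes `p > √n` for which the base `p` digit sum of `n` is at least `p - 1` are determined
by `⌊n / p⌋`. -/
theorem injOn_div_of_digits_sum (n : ℕ) :
    Set.InjOn (fun p => n / p)
      {p : ℕ | p.Prime ∧ n < p ^ 2 ∧ p - 1 ≤ (p.digits n).sum} := by
  -- With `a = ⌊n / p⌋`, the number `(a + 1) p` is a multiple of `a + 1` among the `a + 1`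
  -- consecutive integers `n + 1, …, n + 1 + a`. There is only one, so `a` determines `p`.
  have key : ∀ p ∈ {p : ℕ | p.Prime ∧ n < p ^ 2 ∧ p - 1 ≤ (p.digits n).sum},
      n + 1 ≤ (n / p + 1) * p ∧ (n / p + 1) * p ≤ n + 1 + n / p := by
    rintro p ⟨hp, hlt, hs⟩
    rw [digits_sum_of_lt_sq hp hlt] at hs
    have h1 : n % p < p := Nat.mod_lt _ hp.pos
    have h2 := Nat.div_add_mod' n p
    rw [add_mul, one_mul]
    constructor <;> omega
  intro p hp q hq hpq
  have hpq' : n / p = n / q := hpq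
  obtain ⟨h1, h2⟩ := key p hp
  obtain ⟨h3, h4⟩ := key q hq
  rw [← hpq'] at h3 h4
  set a := n / p
  rcases lt_trichotomy p q with h | h | h
  · have := Nat.mul_le_mul_left (a + 1) (Nat.succ_le_of_lt h)
    rw [Nat.mul_succ] at this
    omega
  · exact h
  · have := Nat.mul_le_mul_left (a + 1) (Nat.succ_le_of_lt h)
    rw [Nat.mul_succ] at this
    omega

theorem card_filter_digits_sum_le (n : ℕ) (s : Finset ℕ)
    (hs : ∀ p ∈ s, p.Prime ∧ n < p ^ 2 ∧ p - 1 ≤ (p.digits n).sum) : s.card ≤ n.sqrt + 1 := by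
  rw [← Finset.card_range (n.sqrt + 1)]
  refine Finset.card_le_card_of_injOn (fun p => n / p) (fun p hp => ?_)
    ((injOn_div_of_digits_sum n).mono hs)
  obtain ⟨hpp, hlt, -⟩ := hs p hp
  have h2 : n / p < p := Nat.div_lt_of_lt_mul (by rwa [← sq])
  have h3 : n / p * p ≤ n := Nat.div_mul_le_self n p
  have h4 : n / p ≤ n.sqrt := Nat.le_sqrt.2 ((Nat.mul_le_mul_left _ h2.le).trans h3)
  simp only [Finset.coe_range, Set.mem_Iio]
  omega

/-- There are at most `√n` primes up to `√n`, each contributing at most `2 log n`. A larger prime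
contributes only if its digit sum reaches `p - 1`; at most `√n + 1` do, and each gives at most `2
log p ≤ 4 log n`. The primes run up to `n + 1`, the last for which `⌊n / (p - 1)⌋` can be nonzero.
-/
theorem sum_digits_sum_div_mul_log_le {n : ℕ} (hn : 2 ≤ n) :
    ∑ p ∈ (n + 2).primesBelow, (((p.digits n).sum / (p - 1) : ℕ) : ℝ) * Real.log p ≤
      10 * (Real.sqrt n * Real.log n) := by
  classical
  have hlogn : 0 < Real.log n := Real.log_pos (by exact_mod_cast hn)
  have hsqrt : (n.sqrt : ℝ) ≤ Real.sqrt n := Real.nat_sqrt_le_real_sqrt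
  have hsqrt1 : 1 ≤ Real.sqrt n := Real.one_le_sqrt.2 (by exact_mod_cast (by omega : 1 ≤ n))
  rw [← Finset.sum_filter_add_sum_filter_not _ (fun p => p ^ 2 ≤ n)]
  have h1 : ∑ p ∈ (n + 2).primesBelow with p ^ 2 ≤ n,
      (((p.digits n).sum / (p - 1) : ℕ) : ℝ) * Real.log p ≤ n.sqrt * (2 * Real.log n) := by
    have hcard : ((n + 2).primesBelow.filter fun p => p ^ 2 ≤ n).card ≤ n.sqrt := by
      refine (Finset.card_le_card (t := Finset.Icc 1 n.sqrt) fun p hp => ?_).trans (by simp)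
      rw [Finset.mem_filter, Nat.mem_primesBelow] at hp
      exact Finset.mem_Icc.2 ⟨hp.1.2.pos, Nat.le_sqrt'.2 hp.2⟩
    refine (Finset.sum_le_card_nsmul _ _ (2 * Real.log n) fun p hp => ?_).trans ?_
    · rw [Finset.mem_filter, Nat.mem_primesBelow] at hp
      have := hp.1.2.one_lt
      exact digits_sum_div_sub_one_mul_log_le hp.1.2 (by omega) (by nlinarith)
    · rw [nsmul_eq_mul]
      gcongr
  have h2 : ∑ p ∈ (n + 2).primesBelow with ¬ p ^ 2 ≤ n,
      (((p.digits n).sum / (p - 1) : ℕ) : ℝ) * Real.log p ≤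
        (n.sqrt + 1 : ℕ) * (4 * Real.log n) := by
    rw [← Finset.sum_filter_of_ne (p := fun p => p - 1 ≤ (p.digits n).sum)]
    · refine (Finset.sum_le_card_nsmul _ _ (4 * Real.log n) fun p hp => ?_).trans ?_
      · simp only [Finset.mem_filter, Nat.mem_primesBelow, not_le] at hp
        have ha : (((p.digits n).sum / (p - 1) : ℕ) : ℝ) ≤ 2 := by
          exact_mod_cast digits_sum_div_le_two hp.1.1.2 hp.1.2
        have hb : Real.log p ≤ 2 * Real.log n := by
          rw [show (2 : ℝ) = (2 : ℕ) by norm_num, ← Real.log_pow]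
          refine Real.log_le_log (by exact_mod_cast hp.1.1.2.pos) ?_
          have : p ≤ n ^ 2 := by nlinarith [hp.1.1.1]
          exact_mod_cast this
        have hc : 0 ≤ Real.log p := Real.log_natCast_nonneg p
        nlinarith
      · rw [nsmul_eq_mul]
        gcongr
        refine card_filter_digits_sum_le n _ fun p hp => ?_
        simp only [Finset.mem_filter, Nat.mem_primesBelow, not_le] at hp
        exact ⟨hp.1.1.2, hp.1.2, hp.2⟩
    · intro p hp hne
      by_contra hlt
      rw [Nat.div_eq_of_lt (not_le.1 hlt)] at hne
      simp at hne
  push_cast at h2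
  -- The constant `10` comes from `2 √n + 4 (√n + 1) ≤ 10 √n`, as `√n ≥ 1`.
  nlinarith [mul_le_mul_of_nonneg_right hsqrt hlogn.le, mul_le_mul_of_nonneg_right hsqrt1 hlogn.le]

theorem log_factorial_eq_sum_primesBelow (n : ℕ) :
    Real.log n.factorial =
      ∑ p ∈ (n + 2).primesBelow, (n.factorial.factorization p : ℝ) * Real.log p := by
  rw [Real.log_nat_eq_sum_factorization, Finsupp.sum]
  refine Finset.sum_subset (fun p hp => ?_) fun p _ hp => ?_
  · rw [Nat.support_factorization, Nat.mem_primeFactors] at hp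
    rw [Nat.mem_primesBelow]
    exact ⟨by have := (hp.1.dvd_factorial).1 hp.2.1; omega, hp.1⟩
  · rw [Finsupp.notMem_support_iff.1 hp]
    simp

theorem sum_div_sub_one_mul_log_le {n : ℕ} (hn : 2 ≤ n) :
    ∑ p ∈ (n + 2).primesBelow, ((n / (p - 1) : ℕ) : ℝ) * Real.log p ≤
      Real.log n.factorial + 10 * (Real.sqrt n * Real.log n) := by
  rw [log_factorial_eq_sum_primesBelow]
  refine le_trans (le_of_eq ?_) (add_le_add_right (sum_digits_sum_div_mul_log_le hn) _)
  rw [← Finset.sum_add_distrib]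
  refine Finset.sum_congr rfl fun p hp => ?_
  rw [div_sub_one_eq_factorization_factorial_add (Nat.mem_primesBelow.1 hp).2]
  push_cast
  ring

theorem log_factorial_le {n : ℕ} (hn : 1 ≤ n) :
    Real.log n.factorial ≤ n * Real.log n - n + 1 + Real.log n := by
  induction n, hn using Nat.le_induction with
  | base => simp
  | succ n hn ih =>
    have hn0 : (0 : ℝ) < n := by exact_mod_cast hn
    rw [Nat.factorial_succ, Nat.cast_mul, Real.log_mul (by positivity) (by positivity)]
    have h := Real.one_sub_inv_le_log_of_pos (x := ((n + 1 : ℕ) : ℝ) / n) (by positivity)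
    rw [Real.log_div (by positivity) (by positivity)] at h
    push_cast at h ⊢
    have h2 : 1 ≤ (n + 1) * (Real.log (n + 1) - Real.log n) := by
      have : (1 : ℝ) = (n + 1) * (1 - ((n + 1 : ℝ) / n)⁻¹) := by field_simp; ring
      have h3 := mul_le_mul_of_nonneg_left h (by positivity : (0 : ℝ) ≤ n + 1)
      linarith
    linarith

end DigitSums

/-! ### Convergence of the prime series. -/

section Summability

theorem schurTerm_nonneg (l : Nat.Primes) : 0 ≤ schurTerm l :=
  div_nonneg (Real.log_natCast_nonneg _) (sq_nonneg _)

theorem summable_schurTerm : Summable schurTerm := by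
  have h : Summable fun l : Nat.Primes => 8 * (((l : ℕ) : ℝ) ^ (3 / 2 : ℝ))⁻¹ :=
    ((Real.summable_nat_rpow_inv.2 (by norm_num : (1 : ℝ) < 3 / 2)).mul_left 8).comp_injective
      Subtype.val_injective
  refine h.of_nonneg_of_le schurTerm_nonneg fun l => ?_
  have hl : (2 : ℝ) ≤ (l : ℕ) := by exact_mod_cast l.2.two_le
  have hl0 : (0 : ℝ) < (l : ℕ) := by linarith
  set x : ℝ := ((l : ℕ) : ℝ)
  have h1 : Real.log x ≤ 2 * x ^ (1 / 2 : ℝ) := by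
    have := Real.log_le_rpow_div hl0.le (by norm_num : (0 : ℝ) < 1 / 2)
    linarith
  have h2 : x ^ (2 : ℝ) / 4 ≤ (x - 1) ^ 2 := by
    rw [Real.rpow_two]
    nlinarith
  rw [schurTerm, ← Real.rpow_neg hl0.le]
  calc Real.log x / (x - 1) ^ 2 ≤ 2 * x ^ (1 / 2 : ℝ) / (x ^ (2 : ℝ) / 4) := by
        gcongr
    _ = 8 * (x ^ (1 / 2 : ℝ) / x ^ (2 : ℝ)) := by ring
    _ = 8 * x ^ (-(3 / 2) : ℝ) := by
        rw [← Real.rpow_sub hl0]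
        norm_num

theorem sum_log_div_sq_le (s : Finset ℕ) (hs : ∀ p ∈ s, p.Prime) :
    ∑ p ∈ s, Real.log p / ((p : ℝ) - 1) ^ 2 ≤ ∑' l, schurTerm l := by
  let emb : s ↪ Nat.Primes := ⟨fun p => ⟨p.1, hs p.1 p.2⟩, fun p q hpq =>
    Subtype.ext (congrArg (fun l : Nat.Primes => (l : ℕ)) hpq)⟩
  have h := Summable.sum_le_tsum (f := schurTerm) (s.attach.map emb)
    (fun l _ => schurTerm_nonneg l) summable_schurTerm
  rw [Finset.sum_map] at h
  rw [← Finset.sum_attach]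
  exact h

end Summability

/-! ### From exponents of primes to the logarithm of the order. -/

section OrderBound

/-- The upper bound for the order of a finite group whose `p`-parts satisfy Schur's bound up to an
error `e p` at a finite set of primes. -/
theorem log_le_of_factorization_le {n m : ℕ} (hn : 2 ≤ n) (e : ℕ → ℝ) (s : Finset ℕ)
    (hs : ∀ p ∈ s, p.Prime) (hes : ∀ p, p ∉ s → e p = 0)
    (h : ∀ p : ℕ, p.Prime →
      (m.factorization p : ℝ) ≤ (n / (p - 1) : ℕ) + n / ((p : ℝ) - 1) ^ 2 + e p) :
    Real.log m ≤ n * Real.log n + (schurConstant - Real.log 2 / 2) * n +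
      (1 + Real.log n + 10 * (Real.sqrt n * Real.log n)) + ∑ p ∈ s, e p * Real.log p := by
  classical
  set t := (n + 2).primesBelow ∪ s with ht
  have htp : ∀ p ∈ t, p.Prime := fun p hp => by
    rcases Finset.mem_union.1 hp with hp | hp
    · exact (Nat.mem_primesBelow.1 hp).2
    · exact hs p hp
  have hfloor : ∀ p ∈ t, p ∉ (n + 2).primesBelow →
      ((n / (p - 1) : ℕ) : ℝ) * Real.log p = 0 := fun p hp hpn => by
    have : n + 2 ≤ p := by
      by_contra hlt
      exact hpn (Nat.mem_primesBelow.2 ⟨by omega, htp p hp⟩)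
    rw [Nat.div_eq_of_lt (by omega)]
    simp
  -- For `p ≥ n + 2` outside `s` the bound is `n / (p - 1)² < 1`, and an exponent is an integer, so
  -- such primes do not divide `m`.
  have hsupp : m.factorization.support ⊆ t := fun p hp => by
    by_contra hpt
    rw [ht, Finset.mem_union, not_or] at hpt
    have hpp : p.Prime := Nat.prime_of_mem_primeFactors hp
    have hlt : n + 2 ≤ p := by
      by_contra hlt
      exact hpt.1 (Nat.mem_primesBelow.2 ⟨by omega, hpp⟩)
    have h1 := h p hpp
    rw [hes p hpt.2, Nat.div_eq_of_lt (by omega), Nat.cast_zero, zero_add, add_zero] at h1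
    have h2 : (n : ℝ) + 2 ≤ p := by exact_mod_cast hlt
    have h0 : (0 : ℝ) ≤ n := by positivity
    have h3 : (n : ℝ) / ((p : ℝ) - 1) ^ 2 < 1 := by
      rw [div_lt_one (by nlinarith)]
      nlinarith
    have h4 : m.factorization p < 1 := by exact_mod_cast h1.trans_lt h3
    exact Finsupp.mem_support_iff.1 hp (by omega)
  have hlog : Real.log m = ∑ p ∈ t, (m.factorization p : ℝ) * Real.log p := by
    rw [Real.log_nat_eq_sum_factorization, Finsupp.sum]
    exact Finset.sum_subset hsupp fun p _ hp => by
      rw [Finsupp.notMem_support_iff.1 hp]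
      simp
  have hsum : Real.log m ≤ ∑ p ∈ t, ((n / (p - 1) : ℕ) : ℝ) * Real.log p +
      n * ∑ p ∈ t, Real.log p / ((p : ℝ) - 1) ^ 2 + ∑ p ∈ t, e p * Real.log p := by
    rw [hlog, Finset.mul_sum, ← Finset.sum_add_distrib, ← Finset.sum_add_distrib]
    refine Finset.sum_le_sum fun p hp => ?_
    calc (m.factorization p : ℝ) * Real.log p
        ≤ ((n / (p - 1) : ℕ) + n / ((p : ℝ) - 1) ^ 2 + e p) * Real.log p :=
          mul_le_mul_of_nonneg_right (h p (htp p hp)) (Real.log_natCast_nonneg p)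
      _ = _ := by ring
  have he : ∑ p ∈ t, e p * Real.log p = ∑ p ∈ s, e p * Real.log p :=
    (Finset.sum_subset Finset.subset_union_right fun p _ hp => by rw [hes p hp, zero_mul]).symm
  rw [← Finset.sum_subset Finset.subset_union_left hfloor, he] at hsum
  have h1 := sum_div_sub_one_mul_log_le hn
  have h2 := log_factorial_le (n := n) (by omega)
  have h3 := mul_le_mul_of_nonneg_left (sum_log_div_sq_le t htp) (Nat.cast_nonneg (α := ℝ) n)
  have h4 : (schurConstant - Real.log 2 / 2) * n = n * (∑' l, schurTerm l) - n := by
    rw [schurConstant]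
    ring
  linarith

end OrderBound

/-! ### Existence of the maximum and the asymptotic bounds. -/

section MaximalOrder

variable {K : Type*} [Field K] [NumberField K]

theorem factorization_le_of_pow_dvd {p v M : ℕ} (hp : p.Prime)
    (h : p ^ v ∣ p ^ (M / (p - 1)) * (M / (p - 1)).factorial) :
    (v : ℝ) ≤ (M / (p - 1) : ℕ) + M / ((p : ℝ) - 1) ^ 2 := by
  set N := M / (p - 1) with hN
  have hp1 : (0 : ℝ) < p - 1 := by
    have : (1 : ℝ) < p := by exact_mod_cast hp.one_lt
    linarith
  have hpN : p ^ N ≠ 0 := pow_ne_zero _ hp.ne_zero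
  rw [hp.pow_dvd_iff_le_factorization (mul_ne_zero hpN (Nat.factorial_ne_zero _)),
    Nat.factorization_mul hpN (Nat.factorial_ne_zero _), Finsupp.add_apply,
    hp.factorization_pow, Finsupp.single_eq_same] at h
  have h1 : (v : ℝ) ≤ N + N.factorial.factorization p := by exact_mod_cast h
  have h2 := factorization_factorial_le_div hp N
  have h3 : (N : ℝ) ≤ M / (p - 1) := by
    have := Nat.cast_div_le (α := ℝ) (m := M) (n := p - 1)
    rwa [Nat.cast_sub hp.one_lt.le, Nat.cast_one] at this
  have h4 : (N : ℝ) / (p - 1) ≤ M / ((p : ℝ) - 1) ^ 2 := by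
    rw [sq, ← div_div]
    gcongr
  linarith

/-- Over `ℚ` Schur's bound holds at every prime in dimension `M = n [K : ℚ]`. It is trivial for `p ≥
M + 2`, so one finite product is a multiple of all the orders. -/
theorem bddAbove_finiteSubgroupOrders (n : ℕ) : BddAbove (finiteSubgroupOrders (𝓞 K) n) := by
  set M := n * Module.finrank ℚ K with hM
  refine ⟨∏ p ∈ (M + 2).primesBelow, p ^ (M / (p - 1)) * (M / (p - 1)).factorial, ?_⟩
  rintro m ⟨G, hG, rfl⟩
  refine Nat.le_of_dvd (Finset.prod_pos fun p hp => Nat.mul_pos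
    (pow_pos (Nat.mem_primesBelow.1 hp).2.pos _) (Nat.factorial_pos _)) ?_
  rw [Nat.dvd_iff_prime_pow_dvd_dvd]
  intro p k hp hk
  have h1 := pow_factorization_card_dvd_of_finrank hp G
  rw [hp.pow_dvd_iff_le_factorization Nat.card_pos.ne'] at hk
  have h2 := (pow_dvd_pow p hk).trans h1
  rw [← hM] at h2
  by_cases hlt : p < M + 2
  · exact h2.trans (Finset.dvd_prod_of_mem (fun p => p ^ (M / (p - 1)) * (M / (p - 1)).factorial)
      (Nat.mem_primesBelow.2 ⟨hlt, hp⟩))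
  · rw [Nat.div_eq_of_lt (by omega)] at h2
    exact h2.trans (by simp)

theorem isGreatest_maxFiniteSubgroupOrder (n : ℕ) :
    IsGreatest (finiteSubgroupOrders (𝓞 K) n) (maxFiniteSubgroupOrder (𝓞 K) n) :=
  ⟨Nat.sSup_mem ⟨1, ⊥, inferInstance, by simp⟩ (bddAbove_finiteSubgroupOrders n),
    fun _ hm => le_csSup (bddAbove_finiteSubgroupOrders n) hm⟩

theorem isBigO_sqrt_mul_log_of_const (c : ℝ) :
    (fun _ : ℕ => c) =O[atTop] fun n : ℕ => Real.sqrt n * Real.log n := by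
  refine IsBigO.of_bound |c| ?_
  filter_upwards [eventually_ge_atTop 3] with n hn
  have hn' : (3 : ℝ) ≤ n := by exact_mod_cast hn
  have h1 : 1 ≤ Real.sqrt n := Real.one_le_sqrt.2 (by linarith)
  have h2 : 1 ≤ Real.log n := by
    rw [Real.le_log_iff_exp_le (by linarith)]
    exact Real.exp_one_lt_three.le.trans hn'
  rw [Real.norm_eq_abs, Real.norm_eq_abs, abs_of_nonneg (by positivity : (0 : ℝ) ≤ √n * Real.log n)]
  nlinarith [abs_nonneg c, mul_le_mul h1 h2 zero_le_one (by linarith)]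

theorem isBigO_sqrt_mul_log_of_log :
    (fun n : ℕ => Real.log n) =O[atTop] fun n : ℕ => Real.sqrt n * Real.log n := by
  refine IsBigO.of_bound 1 ?_
  filter_upwards [eventually_ge_atTop 1] with n hn
  have hn' : (1 : ℝ) ≤ n := by exact_mod_cast hn
  have h1 : 1 ≤ Real.sqrt n := Real.one_le_sqrt.2 hn'
  have h2 : 0 ≤ Real.log n := Real.log_nonneg hn'
  rw [Real.norm_eq_abs, Real.norm_eq_abs, abs_of_nonneg h2, abs_of_nonneg (by positivity)]
  nlinarith

theorem isBigO_natCast_of_sqrt_mul_log :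
    (fun n : ℕ => Real.sqrt n * Real.log n) =O[atTop] fun n : ℕ => (n : ℝ) := by
  have h : (fun x : ℝ => Real.sqrt x * Real.log x) =O[atTop] fun x => x := by
    have h1 : (fun x : ℝ => Real.sqrt x * Real.log x) =O[atTop]
        fun x : ℝ => Real.sqrt x * x ^ (1 / 2 : ℝ) :=
      (isBigO_refl _ _).mul (isLittleO_log_rpow_atTop (by norm_num)).isBigO
    refine h1.congr' .rfl ?_
    filter_upwards [eventually_ge_atTop 0] with x hx
    rw [← Real.sqrt_eq_rpow, Real.mul_self_sqrt hx]
  exact h.comp_tendsto tendsto_natCast_atTop_atTop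

/-- The asymptotic bound when Schur's bound for the rationals holds over `K` for the `p`-part of
finite linear groups up to an error `C p * n + D p`, nonzero for finitely many primes only. -/
theorem leUpToBigO_log_maxFiniteSubgroupOrder (C D : ℕ → ℝ) (s : Finset ℕ)
    (hs : ∀ p ∈ s, p.Prime) (hC : ∀ p, p ∉ s → C p = 0) (hD : ∀ p, p ∉ s → D p = 0)
    (h : ∀ (n : ℕ) (G : Subgroup (GL (Fin n) (𝓞 K))), Finite G → ∀ p : ℕ, p.Prime →
      ((Nat.card G).factorization p : ℝ) ≤
        (n / (p - 1) : ℕ) + n / ((p : ℝ) - 1) ^ 2 + (C p * n + D p))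
    {c : ℝ} (hc : schurConstant - Real.log 2 / 2 + ∑ p ∈ s, C p * Real.log p ≤ c) :
    LEUpToBigO (fun n => Real.log (maxFiniteSubgroupOrder (𝓞 K) n))
      (fun n => n * Real.log n + c * n) (fun n => Real.sqrt n * Real.log n) := by
  refine ⟨fun n => (1 + ∑ p ∈ s, D p * Real.log p) + Real.log n +
    10 * (Real.sqrt n * Real.log n), ?_, ?_⟩
  · exact ((isBigO_sqrt_mul_log_of_const _).add isBigO_sqrt_mul_log_of_log).add
      ((isBigO_refl _ _).const_mul_left 10)
  · filter_upwards [eventually_ge_atTop 2] with n hn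
    obtain ⟨G, hG, hcard⟩ := (isGreatest_maxFiniteSubgroupOrder (K := K) n).1
    rw [← hcard]
    have h1 := log_le_of_factorization_le hn (fun p => C p * n + D p) s hs
      (fun p hp => by rw [hC p hp, hD p hp]; simp) (h n G hG)
    have h2 : ∑ p ∈ s, (C p * n + D p) * Real.log p =
        (∑ p ∈ s, C p * Real.log p) * n + ∑ p ∈ s, D p * Real.log p := by
      rw [Finset.sum_mul, ← Finset.sum_add_distrib]
      exact Finset.sum_congr rfl fun p _ => by ring
    rw [h2] at h1
    have h3 := mul_le_mul_of_nonneg_right hc (Nat.cast_nonneg (α := ℝ) n)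
    linarith

theorem factorization_card_le_of_irreducible {p : ℕ} (hp : p.Prime)
    (hirr : ∀ j, Irreducible (Polynomial.cyclotomic (p ^ j) K)) {n : ℕ}
    (G : Subgroup (GL (Fin n) (𝓞 K))) [Finite G] :
    ((Nat.card G).factorization p : ℝ) ≤ (n / (p - 1) : ℕ) + n / ((p : ℝ) - 1) ^ 2 :=
  factorization_le_of_pow_dvd hp (pow_factorization_card_dvd_of_irreducible hp hirr G)

theorem leUpToBigO_log_maxFiniteSubgroupOrder_natCast :
    LEUpToBigO (fun n => Real.log (maxFiniteSubgroupOrder (𝓞 K) n))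
      (fun n => n * Real.log n) (fun n => n) := by
  classical
  set d := Module.finrank ℚ K
  let s := (discr K).natAbs.primeFactors
  obtain ⟨c, hc⟩ : ∃ c, schurConstant - Real.log 2 / 2 +
      ∑ p ∈ s, (if p ∈ s then (2 * d : ℝ) else 0) * Real.log p ≤ c := ⟨_, le_rfl⟩
  -- Primes dividing the discriminant are handled over `ℚ`, where each of the two terms of the bound
  -- is at most `d * n`; hence `C p = 2 * d`.
  obtain ⟨r, hr, hle⟩ := leUpToBigO_log_maxFiniteSubgroupOrder (K := K)
    (fun p => if p ∈ s then (2 * d : ℝ) else 0) (fun _ => 0) s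
    (fun p hp => Nat.prime_of_mem_primeFactors hp) (fun p hp => if_neg hp) (fun _ _ => rfl)
    (fun n G hG p hp => by
      have hp1 : (1 : ℝ) ≤ p - 1 := by
        have : (2 : ℝ) ≤ p := by exact_mod_cast hp.two_le
        linarith
      split_ifs with hps
      · have h1 := factorization_le_of_pow_dvd hp (pow_factorization_card_dvd_of_finrank hp G)
        have h2 : ((n * d / (p - 1) : ℕ) : ℝ) ≤ n * d := by
          exact_mod_cast Nat.div_le_self _ _
        have h3 : ((n * d : ℕ) : ℝ) / ((p : ℝ) - 1) ^ 2 ≤ n * d := by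
          rw [Nat.cast_mul]
          exact div_le_self (by positivity) (one_le_pow₀ hp1)
        have h4 : (0 : ℝ) ≤ (n / (p - 1) : ℕ) + n / ((p : ℝ) - 1) ^ 2 := by positivity
        linarith
      · have hd : ¬ (p : ℤ) ∣ discr K := fun h => hps (Nat.mem_primeFactors.2
          ⟨hp, Int.natCast_dvd.1 h, Int.natAbs_ne_zero.2 (discr_ne_zero K)⟩)
        simpa using factorization_card_le_of_irreducible hp
          (irreducible_cyclotomic_of_not_dvd_discr hp hd) G) hc
  exact ⟨fun n => c * n + r n, ((isBigO_refl (fun n : ℕ => (n : ℝ)) _).const_mul_left c).add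
    (hr.trans isBigO_natCast_of_sqrt_mul_log), hle.mono fun n hn => hn.trans_eq (add_assoc _ _ _)⟩

variable [IsTotallyReal K]

theorem irreducible_cyclotomic_of_not_isRationalsAdjoinSqrt (hK : Module.finrank ℚ K = 2) {p : ℕ}
    (hp : p.Prime) (h : p = 2 ∨ p ≡ 1 [MOD 4] → ¬ IsRationalsAdjoinSqrt K p) (j : ℕ) :
    Irreducible (Polynomial.cyclotomic (p ^ j) K) := by
  by_cases hp2 : p = 2
  · subst hp2
    exact irreducible_cyclotomic_two_pow_of_totallyReal hK (h (.inl rfl)) j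
  · exact irreducible_cyclotomic_odd_of_totallyReal hK hp hp2 (fun h4 => h (.inr h4)) j

theorem leUpToBigO_of_isRationalsAdjoinSqrt_two (hK : Module.finrank ℚ K = 2)
    (h2 : IsRationalsAdjoinSqrt K 2) :
    LEUpToBigO (fun n => Real.log (maxFiniteSubgroupOrder (𝓞 K) n))
      (fun n => n * Real.log n + (schurConstant + Real.log 2 / 2) * n)
      (fun n => Real.sqrt n * Real.log n) := by
  -- The divisor `4 ^ n * n!` bounds the exponent of `2` by `3n`, against `2n` for Schur's bound
  -- over `ℚ`. The excess `n log 2`, added to `𝒜 - log 2 / 2`, gives `𝒜 + log 2 / 2` exactly.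
  refine leUpToBigO_log_maxFiniteSubgroupOrder (fun p => if p = 2 then 1 else 0) (fun _ => 0) {2}
    (by simpa using Nat.prime_two) (by simp) (by simp) (fun n G hG p hp => ?_) ?_
  · split_ifs with hp2
    · subst hp2
      have h := pow_factorization_two_card_dvd hK h2 G
      have h4 : 4 ^ n * n.factorial = 2 ^ (2 * n) * n.factorial := by rw [pow_mul]; norm_num
      rw [h4, hp.pow_dvd_iff_le_factorization (by positivity),
        Nat.factorization_mul (by positivity) (Nat.factorial_ne_zero _), Finsupp.add_apply,
        hp.factorization_pow, Finsupp.single_eq_same] at h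
      have h5 : (n.factorial.factorization 2 : ℝ) ≤ n := by
        have := factorization_factorial_le_div hp n
        norm_num at this
        exact_mod_cast this
      have h6 : ((Nat.card G).factorization 2 : ℝ) ≤ 2 * n + n.factorial.factorization 2 := by
        exact_mod_cast h
      norm_num
      linarith
    · simpa using factorization_card_le_of_irreducible hp
        (irreducible_cyclotomic_of_not_isRationalsAdjoinSqrt hK hp fun _ h =>
          hp2 (h.eq_of_prime hK hp Nat.prime_two h2)) G
  · simp
    linarith

theorem leUpToBigO_of_isRationalsAdjoinSqrt_prime (hK : Module.finrank ℚ K = 2) {p : ℕ}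
    (hp : p.Prime) (hKp : IsRationalsAdjoinSqrt K p) :
    LEUpToBigO (fun n => Real.log (maxFiniteSubgroupOrder (𝓞 K) n))
      (fun n => n * Real.log n +
        (schurConstant + (p : ℝ) * Real.log p / ((p : ℝ) - 1) ^ 2) * n)
      (fun n => Real.sqrt n * Real.log n) := by
  -- At `p` the bound over `ℚ` in dimension `2n` exceeds the one in dimension `n` by at most `n / (p
  -- - 1) + n / (p - 1)² = n p / (p - 1)²`, plus `1` for the rounding of `n / (p - 1)`.
  refine leUpToBigO_log_maxFiniteSubgroupOrder
    (fun q => if q = p then (p : ℝ) / ((p : ℝ) - 1) ^ 2 else 0) (fun q => if q = p then 1 else 0)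
    {p} (by simpa using hp) (fun q hq => if_neg (by simpa using hq))
    (fun q hq => if_neg (by simpa using hq)) (fun n G hG q hq => ?_) ?_
  · split_ifs with hqp
    · subst hqp
      have h := factorization_le_of_pow_dvd hq (pow_factorization_card_dvd_of_finrank hq G)
      have hp1 : (0 : ℝ) < q - 1 := by
        have : (1 : ℝ) < q := by exact_mod_cast hq.one_lt
        linarith
      have h1 : ((n * Module.finrank ℚ K / (q - 1) : ℕ) : ℝ) ≤ n * 2 / (q - 1) := by
        have := Nat.cast_div_le (α := ℝ) (m := n * Module.finrank ℚ K) (n := q - 1)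
        rw [hK] at this ⊢
        rwa [Nat.cast_sub hq.one_lt.le, Nat.cast_one, Nat.cast_mul, Nat.cast_ofNat] at this
      have h2 : (n : ℝ) / (q - 1) ≤ (n / (q - 1) : ℕ) + 1 := by
        have h3 := Nat.lt_div_mul_add (a := n) (b := q - 1) (Nat.sub_pos_of_lt hq.one_lt)
        have h4 : (n : ℝ) ≤ (n / (q - 1) : ℕ) * (q - 1 : ℕ) + (q - 1 : ℕ) := by
          exact_mod_cast h3.le
        rw [Nat.cast_sub hq.one_lt.le, Nat.cast_one] at h4
        rw [div_le_iff₀ hp1]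
        linarith
      have h5 : (n : ℝ) * 2 / (q - 1) + ((n * Module.finrank ℚ K : ℕ) : ℝ) / ((q : ℝ) - 1) ^ 2 =
          n / (q - 1) + n / ((q : ℝ) - 1) ^ 2 + q / ((q : ℝ) - 1) ^ 2 * n := by
        rw [hK]
        push_cast
        field_simp
        ring
      linarith
    · simpa using factorization_card_le_of_irreducible hq
        (irreducible_cyclotomic_of_not_isRationalsAdjoinSqrt hK hq fun _ h =>
          hqp (h.eq_of_prime hK hq hp hKp)) G
  · have h0 : 0 ≤ Real.log 2 := Real.log_nonneg (by norm_num)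
    simp only [Finset.sum_singleton, if_true]
    have : (p : ℝ) * Real.log p / ((p : ℝ) - 1) ^ 2 = p / ((p : ℝ) - 1) ^ 2 * Real.log p := by ring
    linarith

theorem leUpToBigO_of_not_isRationalsAdjoinSqrt (hK : Module.finrank ℚ K = 2)
    (h2 : ¬ IsRationalsAdjoinSqrt K 2)
    (h : ∀ p : ℕ, p.Prime → p ≡ 1 [MOD 4] → ¬ IsRationalsAdjoinSqrt K p) :
    LEUpToBigO (fun n => Real.log (maxFiniteSubgroupOrder (𝓞 K) n))
      (fun n => n * Real.log n + schurConstant * n) (fun n => Real.sqrt n * Real.log n) := by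
  refine leUpToBigO_log_maxFiniteSubgroupOrder (fun _ => 0) (fun _ => 0) ∅ (by simp) (by simp)
    (by simp) (fun n G hG p hp => ?_) ?_
  · simpa using factorization_card_le_of_irreducible hp
      (irreducible_cyclotomic_of_not_isRationalsAdjoinSqrt hK hp (by
        rintro (rfl | h4)
        · exact h2
        · exact h p hp h4)) G
  -- The argument yields the constant `𝒜 - log 2 / 2`; the difference is given away.
  · have h0 : 0 ≤ Real.log 2 := Real.log_nonneg (by norm_num)
    simp
    linarith

end MaximalOrder

/-! ### Sums over primes via the von Mangoldt function -/

theorem LSeries.term_ofReal_natCast (g : ℕ → ℝ) {k : ℕ} (hk : k ≠ 0) (n : ℕ) :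
    LSeries.term (fun n => (g n : ℂ)) k n = ((g n / (n : ℝ) ^ k : ℝ) : ℂ) := by
  rcases eq_or_ne n 0 with rfl | hn
  · simp [hk]
  · simp [LSeries.term_of_ne_zero hn]

theorem LSeries_ofReal_natCast (g : ℕ → ℝ) {k : ℕ} (hk : k ≠ 0) :
    LSeries (fun n => (g n : ℂ)) k = ((∑' n, g n / (n : ℝ) ^ k : ℝ) : ℂ) := by
  rw [LSeries, Complex.ofReal_tsum]
  exact tsum_congr fun n => LSeries.term_ofReal_natCast g hk n

theorem LSeriesSummable_ofReal_natCast_iff (g : ℕ → ℝ) {k : ℕ} (hk : k ≠ 0) :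
    LSeriesSummable (fun n => (g n : ℂ)) k ↔ Summable fun n => g n / (n : ℝ) ^ k := by
  rw [LSeriesSummable, funext (LSeries.term_ofReal_natCast g hk), Complex.summable_ofReal]

theorem summable_vonMangoldt_div_pow {k : ℕ} (hk : 2 ≤ k) :
    Summable fun n : ℕ => ArithmeticFunction.vonMangoldt n / (n : ℝ) ^ k := by
  rw [← LSeriesSummable_ofReal_natCast_iff _ (by lia)]
  exact ArithmeticFunction.LSeriesSummable_vonMangoldt (by simp; lia)

/-- Dirichlet series form of `Λ * 1 = log`. It trades sums over primes for sums over all integers,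
whose tails can be estimated sharply. -/
theorem tsum_vonMangoldt_div_pow_mul_zeta {k : ℕ} (hk : 2 ≤ k) :
    (∑' n : ℕ, ArithmeticFunction.vonMangoldt n / (n : ℝ) ^ k) * ∑' n : ℕ, 1 / (n : ℝ) ^ k =
      ∑' n : ℕ, Real.log n / (n : ℝ) ^ k := by
  have h1 : LSeriesSummable (fun n => ((ArithmeticFunction.vonMangoldt n : ℝ) : ℂ)) k :=
    ArithmeticFunction.LSeriesSummable_vonMangoldt (by simp; lia)
  have h2 : LSeriesSummable 1 k := LSeriesSummable_one_iff.2 (by simp; lia)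
  have h := LSeries_convolution' h1 h2
  rw [ArithmeticFunction.convolution_vonMangoldt_const_one] at h
  have h3 : (fun n : ℕ => Complex.log n) = fun n : ℕ => ((Real.log n : ℝ) : ℂ) := by
    ext n; simp
  have h4 : (1 : ℕ → ℂ) = fun _ => ((1 : ℝ) : ℂ) := by ext; simp
  rw [h3, h4, LSeries_ofReal_natCast _ (by lia), LSeries_ofReal_natCast _ (by lia),
    LSeries_ofReal_natCast _ (by lia)] at h
  exact_mod_cast h.symm

theorem hasSum_vonMangoldt_prime_pow_div_pow {k p : ℕ} (hk : 2 ≤ k) (hp : p.Prime) :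
    HasSum (fun j : ℕ => ArithmeticFunction.vonMangoldt (p ^ (j + 1)) / ((p ^ (j + 1) : ℕ) : ℝ) ^ k)
      (Real.log p / ((p : ℝ) ^ k - 1)) := by
  have hp1 : (1 : ℝ) < (p : ℝ) ^ k := one_lt_pow₀ (by exact_mod_cast hp.one_lt) (by lia)
  have h := (hasSum_geometric_of_lt_one (r := ((p : ℝ) ^ k)⁻¹) (by positivity)
    (inv_lt_one_of_one_lt₀ hp1)).mul_left (Real.log p / (p : ℝ) ^ k)
  have hp0 : (0 : ℝ) < p := by exact_mod_cast hp.pos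
  have e : Real.log p / ((p : ℝ) ^ k - 1) =
      Real.log p / (p : ℝ) ^ k * (1 - ((p : ℝ) ^ k)⁻¹)⁻¹ := by
    have : (p : ℝ) ^ k - 1 ≠ 0 := by linarith
    field_simp
  rw [e]
  refine h.congr_fun fun j => ?_
  · rw [ArithmeticFunction.vonMangoldt_apply_pow (by lia),
      ArithmeticFunction.vonMangoldt_apply_prime hp]
    push_cast
    rw [inv_pow, div_mul_eq_mul_div, div_eq_div_iff (by positivity) (by positivity)]
    field_simp
    ring

/-- `Λ` lives on prime powers, and for fixed `p` the terms `log p / p^{k(j+1)}` form a geometric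
series. -/
theorem hasSum_log_div_prime_pow_sub_one {k : ℕ} (hk : 2 ≤ k) :
    HasSum (fun p : Nat.Primes => Real.log (p : ℕ) / (((p : ℕ) : ℝ) ^ k - 1))
      (∑' n : ℕ, ArithmeticFunction.vonMangoldt n / (n : ℝ) ^ k) := by
  have hs := summable_vonMangoldt_div_pow hk
  have hsub : (Function.support fun n : ℕ => ArithmeticFunction.vonMangoldt n / (n : ℝ) ^ k) ⊆
      {n | IsPrimePow n} := fun n hn => by
    by_contra h
    exact hn (by simp [ArithmeticFunction.vonMangoldt_eq_zero_iff.2 h])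
  have h1 := (hs.comp_injective (Subtype.val_injective.comp
    Nat.Primes.prodNatEquiv.injective)).prod
  rw [tsum_eq_tsum_primes_of_support_subset_prime_powers hs hsub]
  have h2 : ∀ p : Nat.Primes, ∑' j : ℕ, ArithmeticFunction.vonMangoldt ((p : ℕ) ^ (j + 1)) /
      (((p : ℕ) ^ (j + 1) : ℕ) : ℝ) ^ k = Real.log (p : ℕ) / (((p : ℕ) : ℝ) ^ k - 1) :=
    fun p => (hasSum_vonMangoldt_prime_pow_div_pow hk p.2).tsum_eq
  simp_rw [h2]
  refine Summable.hasSum (h1.congr fun p => ?_)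
  rw [← h2 p]
  exact tsum_congr fun j => by simp

theorem tsum_log_div_prime_pow_sub_one_mul_zeta {k : ℕ} (hk : 2 ≤ k) :
    (∑' p : Nat.Primes, Real.log (p : ℕ) / (((p : ℕ) : ℝ) ^ k - 1)) * ∑' n : ℕ, 1 / (n : ℝ) ^ k =
      ∑' n : ℕ, Real.log n / (n : ℝ) ^ k := by
  rw [(hasSum_log_div_prime_pow_sub_one hk).tsum_eq, tsum_vonMangoldt_div_pow_mul_zeta hk]

theorem summable_log_div_pow {k : ℕ} (hk : 2 ≤ k) :
    Summable fun n : ℕ => Real.log n / (n : ℝ) ^ k := by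
  have h : Summable fun n : ℕ => 2 * (1 / (n : ℝ) ^ ((3 : ℝ) / 2)) :=
    (Real.summable_one_div_nat_rpow.2 (by norm_num)).mul_left _
  refine h.of_nonneg_of_le (fun n => by positivity) fun n => ?_
  rcases n.eq_zero_or_pos with rfl | hn
  · simp [show k ≠ 0 by lia]
  have hn1 : (1 : ℝ) ≤ n := by exact_mod_cast hn
  have h1 := Real.log_le_rpow_div (x := n) (by positivity) (show (0 : ℝ) < 1 / 2 by norm_num)
  have h2 : (n : ℝ) ^ (2 : ℝ) ≤ (n : ℝ) ^ k := by
    rw [← Real.rpow_natCast]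
    exact Real.rpow_le_rpow_of_exponent_le hn1 (by exact_mod_cast hk)
  have h3 : (n : ℝ) ^ (2 : ℝ) = (n : ℝ) ^ ((1 : ℝ) / 2) * (n : ℝ) ^ ((3 : ℝ) / 2) := by
    rw [← Real.rpow_add (by positivity)]; norm_num
  calc Real.log n / (n : ℝ) ^ k ≤ ((n : ℝ) ^ ((1 : ℝ) / 2) / (1 / 2)) / (n : ℝ) ^ (2 : ℝ) := by
        gcongr
    _ = _ := by
        rw [h3]
        have : (n : ℝ) ^ ((1 : ℝ) / 2) ≠ 0 := by positivity
        field_simp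

/-! ### Tails of `∑ log n / n ^ k` by telescoping. -/

theorem tsum_nat_add_le_of_telescope {f G : ℕ → ℝ} {N : ℕ} (hf : ∀ n, N ≤ n → 0 ≤ f n)
    (hG : ∀ n, N ≤ n → 0 ≤ G n) (h : ∀ n, N ≤ n → f n ≤ G n - G (n + 1)) :
    ∑' n, f (n + N) ≤ G N := by
  refine Real.tsum_le_of_sum_range_le (fun n => hf _ (by lia)) fun M => ?_
  calc ∑ n ∈ Finset.range M, f (n + N)
      ≤ ∑ n ∈ Finset.range M, (G (n + N) - G (n + 1 + N)) :=
        Finset.sum_le_sum fun n _ => (h _ (by lia)).trans_eq (by rw [add_right_comm])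
    _ = G N - G (M + N) := by
        rw [Finset.sum_range_sub' (fun n => G (n + N))]; simp
    _ ≤ G N := sub_le_self _ (hG _ (by lia))

theorem le_tsum_nat_add_of_telescope {f G : ℕ → ℝ} {N : ℕ} (hf : ∀ n, N ≤ n → 0 ≤ f n)
    (hs : Summable f) (hG : Tendsto G atTop (nhds 0))
    (h : ∀ n, N ≤ n → G n - G (n + 1) ≤ f n) : G N ≤ ∑' n, f (n + N) := by
  have h1 : Tendsto (fun M => G N - G (M + N)) atTop (nhds (G N - 0)) :=
    ((tendsto_add_atTop_iff_nat N).2 hG).const_sub _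
  rw [sub_zero] at h1
  refine le_of_tendsto' h1 fun M => ?_
  calc G N - G (M + N) = ∑ n ∈ Finset.range M, (G (n + N) - G (n + 1 + N)) := by
        rw [Finset.sum_range_sub' (fun n => G (n + N))]; simp
    _ ≤ ∑ n ∈ Finset.range M, f (n + N) :=
        Finset.sum_le_sum fun n _ => Eq.trans_le (by rw [add_right_comm]) (h _ (by lia))
    _ ≤ ∑' n, f (n + N) :=
        ((summable_nat_add_iff N).2 hs).sum_le_tsum _ fun n _ => hf _ (by lia)

/-- The Taylor polynomial of degree `5` of `log (x + 1) - log x` in `1 / x`. -/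
noncomputable def logStep (x : ℝ) : ℝ :=
  1 / x - 1 / (2 * x ^ 2) + 1 / (3 * x ^ 3) - 1 / (4 * x ^ 4) + 1 / (5 * x ^ 5)

theorem abs_log_add_one_sub_log_sub_le {x : ℝ} (hx : 2 ≤ x) :
    |Real.log (x + 1) - Real.log x - logStep x| ≤ 2 / x ^ 6 := by
  have hx0 : 0 < x := by linarith
  have ht : |-(1 / x)| = 1 / x := by rw [abs_neg, abs_of_pos (by positivity)]
  have ht2 : 1 / x ≤ 1 / 2 := by gcongr
  have h := Real.abs_log_sub_add_sum_range_le (x := -(1 / x)) (by rw [ht]; linarith) 5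
  have hl : Real.log (1 - -(1 / x)) = Real.log (x + 1) - Real.log x := by
    rw [← Real.log_div (by positivity) (by positivity)]
    congr 1
    field_simp
    ring
  rw [ht, hl] at h
  have e : (∑ i ∈ Finset.range 5, (-(1 / x)) ^ (i + 1) / ((i : ℝ) + 1)) =
      -logStep x := by
    rw [logStep, show -(1 / x) = -1 / x by ring]
    simp only [Finset.sum_range_succ, Finset.sum_range_zero, div_pow]
    norm_num
    field_simp
    ring
  rw [e, neg_add_eq_sub] at h
  refine h.trans ?_
  rw [one_div, inv_pow, div_le_div_iff₀ (by rw [← one_div]; linarith) (by positivity)]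
  rw [inv_mul_cancel₀ (by positivity), ← one_div]
  linarith

theorem three_le_log {x : ℝ} (hx : 32 ≤ x) : 3 ≤ Real.log x := by
  have h : Real.log (2 ^ 5) ≤ Real.log x := Real.log_le_log (by norm_num) (by linarith)
  rw [Real.log_pow] at h
  push_cast at h
  linarith [Real.log_two_gt_d9]

/-- Bounds for the tail of `∑ log n / n ^ k` from an approximate antidifference
`log x * a x + b x` of its terms. -/
theorem tsum_log_div_pow_tail_mem {k : ℕ} (hk : 2 ≤ k) {a b : ℝ → ℝ} (ha : ∀ x, 32 ≤ x → 0 ≤ a x)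
    (hb : ∀ x, 32 ≤ x → 0 ≤ b x) (hE : ∀ x, 32 ≤ x → 0 ≤ a x - a (x + 1) - 1 / x ^ k)
    (hup : ∀ x, 32 ≤ x → 0 ≤ 3 * (a x - a (x + 1) - 1 / x ^ k) + (b x - b (x + 1)) -
      a (x + 1) * (logStep x + 2 / x ^ 6))
    (hlo : ∀ x, 32 ≤ x → 0 ≤ (1 / x ^ 4 - 1 / (x + 1) ^ 4) / 20 -
      (x * (a x - a (x + 1) - 1 / x ^ k) + (b x - b (x + 1)) -
        a (x + 1) * (logStep x - 2 / x ^ 6)))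
    (hlim : Tendsto (fun n : ℕ => Real.log n * a n + b n) atTop (nhds 0)) :
    Real.log 32 * a 32 + b 32 - 1 / 20971520 ≤
        ∑' n : ℕ, Real.log n / (n : ℝ) ^ k - ∑ n ∈ Finset.range 32, Real.log n / (n : ℝ) ^ k ∧
      ∑' n : ℕ, Real.log n / (n : ℝ) ^ k - ∑ n ∈ Finset.range 32, Real.log n / (n : ℝ) ^ k ≤
        Real.log 32 * a 32 + b 32 := by
  have hs := summable_log_div_pow hk
  rw [← hs.sum_add_tsum_nat_add 32, add_sub_cancel_left]
  have hf : ∀ n : ℕ, 32 ≤ n → 0 ≤ Real.log n / (n : ℝ) ^ k := fun n _ => by positivity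
  have hcast : ∀ n : ℕ, 32 ≤ n → (32 : ℝ) ≤ n := fun n hn => by exact_mod_cast hn
  -- With `G = log · a + b` and `E = a(x) - a(x+1) - 1/x^k ≥ 0`, one has `G(x) - G(x+1) - log x /
  -- x^k = E log x + b(x) - b(x+1) - a(x+1) (log (x+1) - log x)`. Bounding `log x` below by `3` and
  -- above by `x` leaves the rational inequalities `hup` and `hlo`; the loss in the latter is `1 /
  -- (20 · 32⁴) = 1 / 20971520`.
  have hE' : ∀ (x : ℝ), Real.log x / x ^ k = Real.log x * (1 / x ^ k) := fun x => by ring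
  constructor
  · have hl4 := (((tendsto_inv_atTop_nhds_zero_nat (𝕜 := ℝ)).pow 4).div_const 20)
    have h := le_tsum_nat_add_of_telescope hf hs
      (G := fun n : ℕ => Real.log n * a n + b n - 1 / (n : ℝ) ^ 4 / 20)
      (by simpa using hlim.sub hl4) fun n hn => by
      have hx := hcast n hn
      have h1 := (abs_le.1 (abs_log_add_one_sub_log_sub_le (show (2 : ℝ) ≤ n by linarith))).1
      have h2 := mul_le_mul_of_nonneg_left h1 (ha (n + 1) (by linarith))
      have h3 := mul_le_mul_of_nonneg_right
        ((Real.log_le_sub_one_of_pos (show (0 : ℝ) < n by linarith)).trans (sub_le_self _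
          one_pos.le))
        (hE n hx)
      have h4 := hlo n hx
      rw [hE']
      push_cast
      linarith
    norm_num at h ⊢
    exact h
  · have h := tsum_nat_add_le_of_telescope hf
      (G := fun n : ℕ => Real.log n * a n + b n)
      (fun n hn => add_nonneg (mul_nonneg (by positivity) (ha _ (hcast n hn))) (hb _ (hcast n hn)))
      fun n hn => by
        have hx := hcast n hn
        have h1 := (abs_le.1 (abs_log_add_one_sub_log_sub_le (show (2 : ℝ) ≤ n by linarith))).2
        have h2 := mul_le_mul_of_nonneg_left h1 (ha (n + 1) (by linarith))
        have h3 := mul_le_mul_of_nonneg_right (three_le_log hx) (hE n hx)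
        have h4 := hup n hx
        rw [hE']
        push_cast
        linarith
    exact_mod_cast h

theorem tendsto_log_natCast_div : Tendsto (fun n : ℕ => Real.log n / n) atTop (nhds 0) := by
  have h := (Real.tendsto_pow_log_div_mul_add_atTop 1 0 1 one_ne_zero).comp
    tendsto_natCast_atTop_atTop
  simpa [Function.comp_def] using h

/-- Here `log x * a x + b x` is the Euler–Maclaurin expression `∫_x^∞ f + f(x)/2 - f'(x)/12` for
`f(t) = log t / t²`. The cubic and quartic cases use the same recipe. -/
theorem tsum_log_div_sq_tail_mem :
    Real.log 32 * (1 / 32 + 1 / (2 * 32 ^ 2) + 1 / (6 * 32 ^ 3)) + (1 / 32 - 1 / (12 * 32 ^ 3)) -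
        1 / 20971520 ≤
      ∑' n : ℕ, Real.log n / (n : ℝ) ^ 2 - ∑ n ∈ Finset.range 32, Real.log n / (n : ℝ) ^ 2 ∧
    ∑' n : ℕ, Real.log n / (n : ℝ) ^ 2 - ∑ n ∈ Finset.range 32, Real.log n / (n : ℝ) ^ 2 ≤
      Real.log 32 * (1 / 32 + 1 / (2 * 32 ^ 2) + 1 / (6 * 32 ^ 3)) +
        (1 / 32 - 1 / (12 * 32 ^ 3)) := by
  refine tsum_log_div_pow_tail_mem le_rfl
    (a := fun x => 1 / x + 1 / (2 * x ^ 2) + 1 / (6 * x ^ 3))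
    (b := fun x => 1 / x - 1 / (12 * x ^ 3)) (fun x hx => by positivity) ?_ ?_ ?_ ?_ ?_
  -- After the substitution `x = m + 32` only nonnegative coefficients remain, and `positivity`
  -- closes the four rational inequalities.
  iterate 4
    · intro x hx
      obtain ⟨m, hm, rfl⟩ : ∃ m, 0 ≤ m ∧ x = m + 32 := ⟨x - 32, by linarith, by ring⟩
      try simp only [logStep]
      field_simp
      ring_nf
      positivity
  · have hu := tendsto_inv_atTop_nhds_zero_nat (𝕜 := ℝ)
    -- `G(n)` is a polynomial in `log n / n` and `1 / n` vanishing at the origin.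
    have hc : Continuous fun p : ℝ × ℝ =>
      p.1 * (1 + p.2 / 2 + p.2 ^ 2 / 6) + (p.2 - p.2 ^ 3 / 12) := by fun_prop
    have h := (hc.tendsto (0, 0)).comp (tendsto_log_natCast_div.prodMk_nhds hu)
    norm_num [Function.comp_def] at h
    refine h.congr fun n => ?_
    rcases eq_or_ne n 0 with rfl | hn
    · simp
    · field_simp

theorem tsum_log_div_cube_tail_mem :
    Real.log 32 * (1 / (2 * 32 ^ 2) + 1 / (2 * 32 ^ 3) + 1 / (4 * 32 ^ 4)) +
        (1 / (4 * 32 ^ 2) - 1 / (12 * 32 ^ 4)) - 1 / 20971520 ≤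
      ∑' n : ℕ, Real.log n / (n : ℝ) ^ 3 - ∑ n ∈ Finset.range 32, Real.log n / (n : ℝ) ^ 3 ∧
    ∑' n : ℕ, Real.log n / (n : ℝ) ^ 3 - ∑ n ∈ Finset.range 32, Real.log n / (n : ℝ) ^ 3 ≤
      Real.log 32 * (1 / (2 * 32 ^ 2) + 1 / (2 * 32 ^ 3) + 1 / (4 * 32 ^ 4)) +
        (1 / (4 * 32 ^ 2) - 1 / (12 * 32 ^ 4)) := by
  refine tsum_log_div_pow_tail_mem (by norm_num)
    (a := fun x => 1 / (2 * x ^ 2) + 1 / (2 * x ^ 3) + 1 / (4 * x ^ 4))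
    (b := fun x => 1 / (4 * x ^ 2) - 1 / (12 * x ^ 4)) (fun x hx => by positivity) ?_ ?_ ?_ ?_ ?_
  iterate 4
    · intro x hx
      obtain ⟨m, hm, rfl⟩ : ∃ m, 0 ≤ m ∧ x = m + 32 := ⟨x - 32, by linarith, by ring⟩
      try simp only [logStep]
      field_simp
      ring_nf
      positivity
  · have hu := tendsto_inv_atTop_nhds_zero_nat (𝕜 := ℝ)
    have hc : Continuous fun p : ℝ × ℝ =>
      p.1 * (p.2 / 2 + p.2 ^ 2 / 2 + p.2 ^ 3 / 4) + (p.2 ^ 2 / 4 - p.2 ^ 4 / 12) := by fun_prop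
    have h := (hc.tendsto (0, 0)).comp (tendsto_log_natCast_div.prodMk_nhds hu)
    norm_num [Function.comp_def] at h
    refine h.congr fun n => ?_
    rcases eq_or_ne n 0 with rfl | hn
    · simp
    · field_simp

theorem tsum_log_div_fourth_tail_mem :
    Real.log 32 * (1 / (3 * 32 ^ 3) + 1 / (2 * 32 ^ 4) + 1 / (3 * 32 ^ 5)) +
        (1 / (9 * 32 ^ 3) - 1 / (12 * 32 ^ 5)) - 1 / 20971520 ≤
      ∑' n : ℕ, Real.log n / (n : ℝ) ^ 4 - ∑ n ∈ Finset.range 32, Real.log n / (n : ℝ) ^ 4 ∧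
    ∑' n : ℕ, Real.log n / (n : ℝ) ^ 4 - ∑ n ∈ Finset.range 32, Real.log n / (n : ℝ) ^ 4 ≤
      Real.log 32 * (1 / (3 * 32 ^ 3) + 1 / (2 * 32 ^ 4) + 1 / (3 * 32 ^ 5)) +
        (1 / (9 * 32 ^ 3) - 1 / (12 * 32 ^ 5)) := by
  refine tsum_log_div_pow_tail_mem (by norm_num)
    (a := fun x => 1 / (3 * x ^ 3) + 1 / (2 * x ^ 4) + 1 / (3 * x ^ 5))
    (b := fun x => 1 / (9 * x ^ 3) - 1 / (12 * x ^ 5)) (fun x hx => by positivity) ?_ ?_ ?_ ?_ ?_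
  iterate 4
    · intro x hx
      obtain ⟨m, hm, rfl⟩ : ∃ m, 0 ≤ m ∧ x = m + 32 := ⟨x - 32, by linarith, by ring⟩
      try simp only [logStep]
      field_simp
      ring_nf
      positivity
  · have hu := tendsto_inv_atTop_nhds_zero_nat (𝕜 := ℝ)
    have hc : Continuous fun p : ℝ × ℝ =>
      p.1 * (p.2 ^ 2 / 3 + p.2 ^ 3 / 2 + p.2 ^ 4 / 3) + (p.2 ^ 3 / 9 - p.2 ^ 5 / 12) := by fun_prop
    have h := (hc.tendsto (0, 0)).comp (tendsto_log_natCast_div.prodMk_nhds hu)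
    norm_num [Function.comp_def] at h
    refine h.congr fun n => ?_
    rcases eq_or_ne n 0 with rfl | hn
    · simp
    · field_simp

/-! ### Logarithms of the primes from `7` to `31`. -/

/-- For a prime `q` the number `q² - 1 = (q - 1)(q + 1)` has only smaller prime factors, so `log q`
follows from logarithms already known, with a very small Taylor error. -/
theorem abs_two_mul_log_sub_le {q : ℝ} (hq : 2 ≤ q) :
    |2 * Real.log q - Real.log (q ^ 2 - 1) - logStep (q ^ 2 - 1)| ≤ 2 / (q ^ 2 - 1) ^ 6 := by
  have h := abs_log_add_one_sub_log_sub_le (x := q ^ 2 - 1) (by nlinarith)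
  rwa [sub_add_cancel, Real.log_pow, Nat.cast_ofNat] at h

theorem log_seven_mem : 1.945910139 < Real.log 7 ∧ Real.log 7 < 1.945910160 := by
  have h := abs_le.1 (abs_two_mul_log_sub_le (q := 7) (by norm_num))
  have e : Real.log (7 ^ 2 - 1) = 4 * Real.log 2 + Real.log 3 := by
    rw [show (7 : ℝ) ^ 2 - 1 = 2 ^ 4 * 3 by norm_num]
    simp [Real.log_mul, Real.log_pow]
  rw [e, logStep] at h
  norm_num at h
  constructor <;> linarith [Real.log_two_gt_d9, Real.log_two_lt_d9, Real.log_three_gt_d9,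
    Real.log_three_lt_d9]

theorem log_eleven_mem : 2.397895262 < Real.log 11 ∧ Real.log 11 < 2.397895283 := by
  have h := abs_le.1 (abs_two_mul_log_sub_le (q := 11) (by norm_num))
  have e : Real.log (11 ^ 2 - 1) = 3 * Real.log 2 + Real.log 3 + Real.log 5 := by
    rw [show (11 : ℝ) ^ 2 - 1 = 2 ^ 3 * 3 * 5 by norm_num]
    simp [Real.log_mul, Real.log_pow]
  rw [e, logStep] at h
  norm_num at h
  constructor <;> linarith [Real.log_two_gt_d9, Real.log_two_lt_d9, Real.log_three_gt_d9,
    Real.log_three_lt_d9, Real.log_five_gt_d9, Real.log_five_lt_d9]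

theorem log_thirteen_mem : 2.564949347 < Real.log 13 ∧ Real.log 13 < 2.564949368 := by
  have h := abs_le.1 (abs_two_mul_log_sub_le (q := 13) (by norm_num))
  have e : Real.log (13 ^ 2 - 1) = 3 * Real.log 2 + Real.log 3 + Real.log 7 := by
    rw [show (13 : ℝ) ^ 2 - 1 = 2 ^ 3 * 3 * 7 by norm_num]
    simp [Real.log_mul, Real.log_pow]
  rw [e, logStep] at h
  norm_num at h
  constructor <;> linarith [Real.log_two_gt_d9, Real.log_two_lt_d9, Real.log_three_gt_d9,
    Real.log_three_lt_d9, log_seven_mem.1, log_seven_mem.2]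

theorem log_seventeen_mem : 2.833213334 < Real.log 17 ∧ Real.log 17 < 2.833213355 := by
  have h := abs_le.1 (abs_two_mul_log_sub_le (q := 17) (by norm_num))
  have e : Real.log (17 ^ 2 - 1) = 5 * Real.log 2 + 2 * Real.log 3 := by
    rw [show (17 : ℝ) ^ 2 - 1 = 2 ^ 5 * 3 ^ 2 by norm_num]
    simp [Real.log_mul, Real.log_pow]
  rw [e, logStep] at h
  norm_num at h
  constructor <;> linarith [Real.log_two_gt_d9, Real.log_two_lt_d9, Real.log_three_gt_d9,
    Real.log_three_lt_d9]

theorem log_nineteen_mem : 2.944438969 < Real.log 19 ∧ Real.log 19 < 2.944438990 := by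
  have h := abs_le.1 (abs_two_mul_log_sub_le (q := 19) (by norm_num))
  have e : Real.log (19 ^ 2 - 1) = 3 * Real.log 2 + 2 * Real.log 3 + Real.log 5 := by
    rw [show (19 : ℝ) ^ 2 - 1 = 2 ^ 3 * 3 ^ 2 * 5 by norm_num]
    simp [Real.log_mul, Real.log_pow]
  rw [e, logStep] at h
  norm_num at h
  constructor <;> linarith [Real.log_two_gt_d9, Real.log_two_lt_d9, Real.log_three_gt_d9,
    Real.log_three_lt_d9, Real.log_five_gt_d9, Real.log_five_lt_d9]

theorem log_twenty_three_mem : 3.135494205 < Real.log 23 ∧ Real.log 23 < 3.135494226 := by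
  have h := abs_le.1 (abs_two_mul_log_sub_le (q := 23) (by norm_num))
  have e : Real.log (23 ^ 2 - 1) = 4 * Real.log 2 + Real.log 3 + Real.log 11 := by
    rw [show (23 : ℝ) ^ 2 - 1 = 2 ^ 4 * 3 * 11 by norm_num]
    simp [Real.log_mul, Real.log_pow]
  rw [e, logStep] at h
  norm_num at h
  constructor <;> linarith [Real.log_two_gt_d9, Real.log_two_lt_d9, Real.log_three_gt_d9,
    Real.log_three_lt_d9, log_eleven_mem.1, log_eleven_mem.2]

theorem log_twenty_nine_mem : 3.367295819 < Real.log 29 ∧ Real.log 29 < 3.367295840 := by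
  have h := abs_le.1 (abs_two_mul_log_sub_le (q := 29) (by norm_num))
  have e : Real.log (29 ^ 2 - 1) = 3 * Real.log 2 + Real.log 3 + Real.log 5 + Real.log 7 := by
    rw [show (29 : ℝ) ^ 2 - 1 = 2 ^ 3 * 3 * 5 * 7 by norm_num]
    simp [Real.log_mul, Real.log_pow]
  rw [e, logStep] at h
  norm_num at h
  constructor <;> linarith [Real.log_two_gt_d9, Real.log_two_lt_d9, Real.log_three_gt_d9,
    Real.log_three_lt_d9, Real.log_five_gt_d9, Real.log_five_lt_d9, log_seven_mem.1,
    log_seven_mem.2]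

theorem log_thirty_one_mem : 3.433987194 < Real.log 31 ∧ Real.log 31 < 3.433987215 := by
  have h := abs_le.1 (abs_two_mul_log_sub_le (q := 31) (by norm_num))
  have e : Real.log (31 ^ 2 - 1) = 6 * Real.log 2 + Real.log 3 + Real.log 5 := by
    rw [show (31 : ℝ) ^ 2 - 1 = 2 ^ 6 * 3 * 5 by norm_num]
    simp [Real.log_mul, Real.log_pow]
  rw [e, logStep] at h
  norm_num at h
  constructor <;> linarith [Real.log_two_gt_d9, Real.log_two_lt_d9, Real.log_three_gt_d9,
    Real.log_three_lt_d9, Real.log_five_gt_d9, Real.log_five_lt_d9]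

/-! ### Numerical values of `ζ(3)` and of `∑ log n / n ^ k`. -/

/-- The upper antidifference `1 / (2 (n - 1/2)²)` is the midpoint rule for the convex function
`t⁻³`. The lower one, with `1/2` for `1/4`, has difference exactly `n / (n⁴ + 1/4) ≤ 1 / n³`. -/
theorem tsum_one_div_cube_mem :
    1.2020569 < ∑' n : ℕ, 1 / (n : ℝ) ^ 3 ∧ ∑' n : ℕ, 1 / (n : ℝ) ^ 3 < 1.20205704 := by
  have hs : Summable fun n : ℕ => 1 / (n : ℝ) ^ 3 := Real.summable_one_div_nat_pow.2 (by norm_num)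
  have hf : ∀ n : ℕ, 32 ≤ n → 0 ≤ 1 / (n : ℝ) ^ 3 := fun n _ => by positivity
  have hcast : ∀ n : ℕ, 32 ≤ n → ∃ m : ℝ, 0 ≤ m ∧ (n : ℝ) = m + 32 := fun n hn =>
    ⟨n - 32, by rw [sub_nonneg]; exact_mod_cast hn, by ring⟩
  have hup := tsum_nat_add_le_of_telescope hf
    (G := fun n : ℕ => 1 / (2 * ((n : ℝ) ^ 2 - n + 1 / 4)))
    (fun n hn => by
      obtain ⟨m, hm, h⟩ := hcast n hn
      have : 0 < (n : ℝ) ^ 2 - n + 1 / 4 := by rw [h]; ring_nf; positivity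
      positivity)
    fun n hn => by
      obtain ⟨m, hm, h⟩ := hcast n hn
      push_cast
      rw [h]
      have h1 : 0 < (m + 32) ^ 2 - (m + 32) + 1 / 4 := by ring_nf; positivity
      have h2 : 0 < (m + 32 + 1) ^ 2 - (m + 32 + 1) + 1 / 4 := by ring_nf; positivity
      rw [div_sub_div _ _ (by positivity) (by positivity), div_le_div_iff₀ (by positivity)
        (by positivity), ← sub_nonneg]
      ring_nf
      positivity
  have hlo := le_tsum_nat_add_of_telescope hf hs
    (G := fun n : ℕ => 1 / (2 * ((n : ℝ) ^ 2 - n + 1 / 2)))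
    (by
      have h1 : Tendsto (fun n : ℕ => 1 / (n : ℝ)) atTop (nhds 0) :=
        tendsto_one_div_atTop_nhds_zero_nat
      refine squeeze_zero' (.of_forall fun n => ?_) ?_ h1
      · have : 0 < (n : ℝ) ^ 2 - n + 1 / 2 := by nlinarith [sq_nonneg ((n : ℝ) - 1)]
        positivity
      · filter_upwards [eventually_ge_atTop 1] with n hn
        have : (1 : ℝ) ≤ n := by exact_mod_cast hn
        apply one_div_le_one_div_of_le (by linarith)
        nlinarith [sq_nonneg ((n : ℝ) - 1)])
    fun n hn => by
      obtain ⟨m, hm, h⟩ := hcast n hn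
      push_cast
      rw [h]
      have h1 : 0 < (m + 32) ^ 2 - (m + 32) + 1 / 2 := by ring_nf; positivity
      have h2 : 0 < (m + 32 + 1) ^ 2 - (m + 32 + 1) + 1 / 2 := by ring_nf; positivity
      rw [div_sub_div _ _ (by positivity) (by positivity), div_le_div_iff₀ (by positivity)
        (by positivity), ← sub_nonneg]
      ring_nf
      positivity
  rw [← hs.sum_add_tsum_nat_add 32]
  norm_num [Finset.sum_range_succ] at hup hlo ⊢
  constructor <;> linarith

theorem sum_range_log_div_pow (k : ℕ) :
    ∑ n ∈ Finset.range 32, Real.log n / (n : ℝ) ^ k =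
      Real.log 2 * (1 / 2 ^ k + 2 / 4 ^ k + 1 / 6 ^ k + 3 / 8 ^ k + 1 / 10 ^ k + 2 / 12 ^ k + 1
        / 14 ^ k + 4 / 16 ^ k + 1 / 18 ^ k + 2 / 20 ^ k + 1 / 22 ^ k + 3 / 24 ^ k + 1 / 26 ^ k +
        2 / 28 ^ k + 1 / 30 ^ k) + Real.log 3 * (1 / 3 ^ k + 1 / 6 ^ k + 2 / 9 ^ k + 1 / 12 ^ k
        + 1 / 15 ^ k + 2 / 18 ^ k + 1 / 21 ^ k + 1 / 24 ^ k + 3 / 27 ^ k + 1 / 30 ^ k) +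
        Real.log 5 * (1 / 5 ^ k + 1 / 10 ^ k + 1 / 15 ^ k + 1 / 20 ^ k + 2 / 25 ^ k + 1 / 30 ^
        k) + Real.log 7 * (1 / 7 ^ k + 1 / 14 ^ k + 1 / 21 ^ k + 1 / 28 ^ k) + Real.log 11 * (1
        / 11 ^ k + 1 / 22 ^ k) + Real.log 13 * (1 / 13 ^ k + 1 / 26 ^ k) + Real.log 17 * (1 / 17
        ^ k) + Real.log 19 * (1 / 19 ^ k) + Real.log 23 * (1 / 23 ^ k) + Real.log 29 * (1 / 29 ^
        k) + Real.log 31 * (1 / 31 ^ k) := by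
  have h : ∀ a b c : ℝ, 0 < a → 0 < b → a * b = c → Real.log c = Real.log a + Real.log b :=
    fun a b c ha hb hc => by rw [← hc, Real.log_mul ha.ne' hb.ne']
  simp only [Finset.sum_range_succ, Finset.sum_range_zero, Nat.cast_ofNat, Nat.cast_zero,
    Nat.cast_one, Real.log_zero, Real.log_one]
  -- The composite numbers are split in decreasing order, so that composite cofactors are split in
  -- turn.
  rw [h 2 15 30 (by norm_num) (by norm_num) (by norm_num), h 2 14 28 (by norm_num) (by norm_num) (by
    norm_num), h 3 9 27 (by norm_num) (by norm_num) (by norm_num), h 2 13 26 (by norm_num) (by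
    norm_num) (by norm_num), h 5 5 25 (by norm_num) (by norm_num) (by norm_num), h 2 12 24 (by
    norm_num) (by norm_num) (by norm_num), h 2 11 22 (by norm_num) (by norm_num) (by norm_num),
    h 3 7 21 (by norm_num) (by norm_num) (by norm_num), h 2 10 20 (by norm_num) (by norm_num)
    (by norm_num), h 2 9 18 (by norm_num) (by norm_num) (by norm_num), h 2 8 16 (by norm_num)
    (by norm_num) (by norm_num), h 3 5 15 (by norm_num) (by norm_num) (by norm_num), h 2 7 14
    (by norm_num) (by norm_num) (by norm_num), h 2 6 12 (by norm_num) (by norm_num) (by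
    norm_num), h 2 5 10 (by norm_num) (by norm_num) (by norm_num), h 3 3 9 (by norm_num) (by
    norm_num) (by norm_num), h 2 4 8 (by norm_num) (by norm_num) (by norm_num), h 2 3 6 (by
    norm_num) (by norm_num) (by norm_num), h 2 2 4 (by norm_num) (by norm_num) (by norm_num)]
  ring

theorem tsum_log_div_sq_mem :
    0.9375481 < ∑' n : ℕ, Real.log n / (n : ℝ) ^ 2 ∧ ∑' n : ℕ, Real.log n / (n : ℝ) ^ 2 < 0.9375484
      := by
  have h := tsum_log_div_sq_tail_mem
  rw [sum_range_log_div_pow, show (32 : ℝ) = 2 ^ 5 by norm_num, Real.log_pow] at h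
  norm_num at h
  constructor <;> linarith [Real.log_two_gt_d9, Real.log_two_lt_d9, Real.log_three_gt_d9,
    Real.log_three_lt_d9,
      Real.log_five_gt_d9, Real.log_five_lt_d9, log_seven_mem.1, log_seven_mem.2,
      log_eleven_mem.1, log_eleven_mem.2, log_thirteen_mem.1, log_thirteen_mem.2,
      log_seventeen_mem.1, log_seventeen_mem.2, log_nineteen_mem.1, log_nineteen_mem.2,
      log_twenty_three_mem.1, log_twenty_three_mem.2, log_twenty_nine_mem.1,
      log_twenty_nine_mem.2, log_thirty_one_mem.1, log_thirty_one_mem.2]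

theorem tsum_log_div_cube_mem :
    0.198126 < ∑' n : ℕ, Real.log n / (n : ℝ) ^ 3 ∧ ∑' n : ℕ, Real.log n / (n : ℝ) ^ 3 < 0.1981264
      := by
  have h := tsum_log_div_cube_tail_mem
  rw [sum_range_log_div_pow, show (32 : ℝ) = 2 ^ 5 by norm_num, Real.log_pow] at h
  norm_num at h
  constructor <;> linarith [Real.log_two_gt_d9, Real.log_two_lt_d9, Real.log_three_gt_d9,
    Real.log_three_lt_d9,
      Real.log_five_gt_d9, Real.log_five_lt_d9, log_seven_mem.1, log_seven_mem.2,
      log_eleven_mem.1, log_eleven_mem.2, log_thirteen_mem.1, log_thirteen_mem.2,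
      log_seventeen_mem.1, log_seventeen_mem.2, log_nineteen_mem.1, log_nineteen_mem.2,
      log_twenty_three_mem.1, log_twenty_three_mem.2, log_twenty_nine_mem.1,
      log_twenty_nine_mem.2, log_thirty_one_mem.1, log_thirty_one_mem.2]

theorem tsum_log_div_fourth_mem :
    0.0689111 < ∑' n : ℕ, Real.log n / (n : ℝ) ^ 4 ∧ ∑' n : ℕ, Real.log n / (n : ℝ) ^ 4 < 0.0689114
      := by
  have h := tsum_log_div_fourth_tail_mem
  rw [sum_range_log_div_pow, show (32 : ℝ) = 2 ^ 5 by norm_num, Real.log_pow] at h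
  norm_num at h
  constructor <;> linarith [Real.log_two_gt_d9, Real.log_two_lt_d9, Real.log_three_gt_d9,
    Real.log_three_lt_d9,
      Real.log_five_gt_d9, Real.log_five_lt_d9, log_seven_mem.1, log_seven_mem.2,
      log_eleven_mem.1, log_eleven_mem.2, log_thirteen_mem.1, log_thirteen_mem.2,
      log_seventeen_mem.1, log_seventeen_mem.2, log_nineteen_mem.1, log_nineteen_mem.2,
      log_twenty_three_mem.1, log_twenty_three_mem.2, log_twenty_nine_mem.1,
      log_twenty_nine_mem.2, log_thirty_one_mem.1, log_thirty_one_mem.2]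

/-! ### The remainder of the prime series and the value of `𝒜`. -/

/-- What is left of `1 / (x - 1) ^ 2` after the approximation by multiples of `1 / (x ^ k - 1)` for
`k = 2, 3, 4`. -/
noncomputable def schurRemainder (x : ℝ) : ℝ :=
  1 / (x - 1) ^ 2 - 1 / (x ^ 2 - 1) - 2 / (x ^ 3 - 1) - 2 / (x ^ 4 - 1)

theorem schurRemainder_nonneg {x : ℝ} (hx : 2 ≤ x) : 0 ≤ schurRemainder x := by
  obtain ⟨m, hm, rfl⟩ : ∃ m, 0 ≤ m ∧ x = m + 2 := ⟨x - 2, by linarith, by ring⟩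
  have e : schurRemainder (m + 2) = 1 / (m + 1) ^ 2 - 1 / ((m + 1) * (m + 3)) -
      2 / ((m + 1) * ((m + 2) ^ 2 + (m + 2) + 1)) -
      2 / ((m + 1) * ((m + 3) * ((m + 2) ^ 2 + 1))) := by
    rw [schurRemainder]
    congr <;> ring
  rw [e]
  field_simp
  ring_nf
  positivity

theorem schurRemainder_le {x : ℝ} (hx : 37 ≤ x) : schurRemainder x ≤ 5 / x ^ 5 := by
  obtain ⟨m, hm, rfl⟩ : ∃ m, 0 ≤ m ∧ x = m + 37 := ⟨x - 37, by linarith, by ring⟩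
  have e : schurRemainder (m + 37) = 1 / (m + 36) ^ 2 - 1 / ((m + 36) * (m + 38)) -
      2 / ((m + 36) * ((m + 37) ^ 2 + (m + 37) + 1)) -
      2 / ((m + 36) * ((m + 38) * ((m + 37) ^ 2 + 1))) := by
    rw [schurRemainder]
    congr <;> ring
  rw [e, ← sub_nonneg]
  field_simp
  ring_nf
  positivity

theorem log_le_div_eight {x : ℝ} (hx : 37 ≤ x) : Real.log x ≤ x / 8 := by
  have h := Real.log_le_sub_one_of_pos (show 0 < x / 2 ^ 5 by positivity)
  rw [Real.log_div (by positivity) (by positivity), Real.log_pow] at h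
  push_cast at h
  linarith [Real.log_two_lt_d9]

theorem log_mul_schurRemainder_nonneg {x : ℝ} (hx : 2 ≤ x) : 0 ≤ Real.log x * schurRemainder x :=
  mul_nonneg (Real.log_nonneg (by linarith)) (schurRemainder_nonneg hx)

/-- From `log x ≤ x / 8` and the remainder bound `5 / x⁵` the term is at most `5 / (8 x⁴)`, which is
below the integral of `5 / (8 t⁴)` over `[x - 1, x]`. The right side telescopes. -/
theorem log_mul_schurRemainder_le {x : ℝ} (hx : 37 ≤ x) :
    Real.log x * schurRemainder x ≤ 5 / (24 * (x - 1) ^ 3) - 5 / (24 * x ^ 3) := by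
  have h : Real.log x * schurRemainder x ≤ x / 8 * (5 / x ^ 5) :=
    mul_le_mul (log_le_div_eight hx) (schurRemainder_le hx) (schurRemainder_nonneg (by linarith))
      (by linarith)
  refine h.trans ?_
  obtain ⟨m, hm, rfl⟩ : ∃ m, 0 ≤ m ∧ x = m + 37 := ⟨x - 37, by linarith, by ring⟩
  rw [show m + 37 - 1 = m + 36 by ring, ← sub_nonneg]
  field_simp
  ring_nf
  positivity

theorem sum_primes_log_mul_schurRemainder_mem :
    0.2000222 < ∑ n ∈ Finset.range 37,
      (Set.indicator {p : ℕ | p.Prime} fun n => Real.log n * schurRemainder n) n ∧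
    ∑ n ∈ Finset.range 37,
      (Set.indicator {p : ℕ | p.Prime} fun n => Real.log n * schurRemainder n) n < 0.2000224 := by
  simp only [Set.indicator_apply, Set.mem_ofPred_eq, Finset.sum_range_succ, Finset.sum_range_zero,
    schurRemainder]
  norm_num
  constructor <;> linarith [Real.log_two_gt_d9, Real.log_two_lt_d9, Real.log_three_gt_d9,
    Real.log_three_lt_d9,
      Real.log_five_gt_d9, Real.log_five_lt_d9, log_seven_mem.1, log_seven_mem.2,
      log_eleven_mem.1, log_eleven_mem.2, log_thirteen_mem.1, log_thirteen_mem.2,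
      log_seventeen_mem.1, log_seventeen_mem.2, log_nineteen_mem.1, log_nineteen_mem.2,
      log_twenty_three_mem.1, log_twenty_three_mem.2, log_twenty_nine_mem.1,
      log_twenty_nine_mem.2, log_thirty_one_mem.1, log_thirty_one_mem.2]

theorem tsum_primes_log_mul_schurRemainder_mem
    (hs : Summable fun p : Nat.Primes => Real.log (p : ℕ) * schurRemainder (p : ℕ)) :
    0.2000222 < ∑' p : Nat.Primes, Real.log (p : ℕ) * schurRemainder (p : ℕ) ∧
      ∑' p : Nat.Primes, Real.log (p : ℕ) * schurRemainder (p : ℕ) < 0.200027 := by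
  set f : ℕ → ℝ := Set.indicator {p : ℕ | p.Prime} fun n => Real.log n * schurRemainder n with hf
  have e : ∑' p : Nat.Primes, Real.log (p : ℕ) * schurRemainder (p : ℕ) = ∑' n, f n :=
    tsum_subtype {p : ℕ | p.Prime} fun n : ℕ => Real.log n * schurRemainder n
  have hsf : Summable f := summable_subtype_iff_indicator.1 hs
  have hf0 : ∀ n, 0 ≤ f n := fun n => Set.indicator_nonneg
    (fun p hp => log_mul_schurRemainder_nonneg (by exact_mod_cast Nat.Prime.two_le hp)) n
  -- The cut at `37`, the prime after `31`, leaves only logarithms already estimated; the tail is at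
  -- most `5 / (24 · 36³) < 5 · 10⁻⁶`, small enough for the fifth decimal.
  have htail := tsum_nat_add_le_of_telescope (f := f) (N := 37)
    (G := fun n : ℕ => 5 / (24 * ((n : ℝ) - 1) ^ 3)) (fun n _ => hf0 n)
    (fun n hn => by
      have : (37 : ℝ) ≤ n := by exact_mod_cast hn
      have : 0 < (n : ℝ) - 1 := by linarith
      positivity)
    fun n hn => by
      have hn' : (37 : ℝ) ≤ n := by exact_mod_cast hn
      push_cast
      rw [add_sub_cancel_right]
      exact Set.indicator_apply_le' (fun _ => log_mul_schurRemainder_le hn') fun _ =>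
        (log_mul_schurRemainder_nonneg (by linarith)).trans (log_mul_schurRemainder_le hn')
  have h0 : 0 ≤ ∑' n, f (n + 37) := tsum_nonneg fun n => hf0 _
  have h := sum_primes_log_mul_schurRemainder_mem
  rw [← hf] at h
  norm_num at htail
  rw [e, ← hsf.sum_add_tsum_nat_add 37]
  constructor <;> linarith

theorem schurConstant_mem : 0.57354 ≤ schurConstant ∧ schurConstant < 0.57355 := by
  set Z : ℕ → ℝ := fun k => ∑' p : Nat.Primes, Real.log (p : ℕ) / (((p : ℕ) : ℝ) ^ k - 1) with hZ
  have hsum : ∀ k, 2 ≤ k → HasSum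
      (fun p : Nat.Primes => Real.log (p : ℕ) / (((p : ℕ) : ℝ) ^ k - 1)) (Z k) := fun k hk =>
    (hasSum_log_div_prime_pow_sub_one hk).summable.hasSum
  have hR : HasSum (fun p : Nat.Primes => Real.log (p : ℕ) * schurRemainder (p : ℕ))
      (∑' l, schurTerm l - Z 2 - 2 * Z 3 - 2 * Z 4) := by
    refine (((summable_schurTerm.hasSum.sub (hsum 2 le_rfl)).sub
      ((hsum 3 (by norm_num)).mul_left 2)).sub
      ((hsum 4 (by norm_num)).mul_left 2)).congr_fun fun p => ?_
    rw [schurTerm, schurRemainder]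
    ring
  have h := tsum_primes_log_mul_schurRemainder_mem hR.summable
  rw [hR.tsum_eq] at h
  have h2 := tsum_log_div_prime_pow_sub_one_mul_zeta le_rfl
  have h3 := tsum_log_div_prime_pow_sub_one_mul_zeta (k := 3) (by norm_num)
  have h4 := tsum_log_div_prime_pow_sub_one_mul_zeta (k := 4) (by norm_num)
  rw [hasSum_zeta_two.tsum_eq] at h2
  rw [hasSum_zeta_four.tsum_eq] at h4
  have hp1 := Real.pi_gt_d20
  have hp2 := Real.pi_lt_d20
  have hz2 : 1.644934066 < Real.pi ^ 2 / 6 ∧ Real.pi ^ 2 / 6 < 1.644934068 := by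
    constructor
    · have := pow_lt_pow_left₀ hp1 (by norm_num) two_ne_zero
      norm_num at this ⊢
      linarith
    · have := pow_lt_pow_left₀ hp2 Real.pi_pos.le two_ne_zero
      norm_num at this ⊢
      linarith
  have hz4 : 1.08232323 < Real.pi ^ 4 / 90 ∧ Real.pi ^ 4 / 90 < 1.08232324 := by
    constructor
    · have := pow_lt_pow_left₀ hp1 (by norm_num) four_ne_zero
      norm_num at this ⊢
      linarith
    · have := pow_lt_pow_left₀ hp2 Real.pi_pos.le four_ne_zero
      norm_num at this ⊢
      linarith
  -- Interval division: the prime sum `z` is the quotient of `s = ∑ log n / n ^ k` by `c = ζ(k)`.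
  have key : ∀ {z c s c₁ c₂ s₁ s₂ : ℝ}, z * c = s → 0 < c₁ → c₁ < c ∧ c < c₂ → 0 < s₁ →
      s₁ < s ∧ s < s₂ → s₁ / c₂ < z ∧ z < s₂ / c₁ := by
    intro z c s c₁ c₂ s₁ s₂ h hc₁ hc hs₁ hs
    have hc0 : 0 < c := hc₁.trans hc.1
    obtain rfl : z = s / c := by rw [← h, mul_div_cancel_right₀ _ hc0.ne']
    exact ⟨div_lt_div₀ hs.1 hc.2.le (hs₁.trans hs.1).le hc0,
      div_lt_div₀ hs.2 hc.1.le ((hs₁.trans hs.1).trans hs.2).le hc₁⟩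
  have b2 := key h2 (by norm_num) hz2 (by norm_num) tsum_log_div_sq_mem
  have b3 := key h3 (by norm_num) tsum_one_div_cube_mem (by norm_num) tsum_log_div_cube_mem
  have b4 := key h4 (by norm_num) hz4 (by norm_num) tsum_log_div_fourth_mem
  rw [schurConstant]
  norm_num at h b2 b3 b4 ⊢
  constructor <;> linarith [Real.log_two_gt_d9, Real.log_two_lt_d9]

theorem theorem6p2 :
    -- The series defining the constant converges, and its value is `0.57354…`.
    (Summable schurTerm ∧ 0.57354 ≤ schurConstant ∧ schurConstant < 0.57355) ∧
    ∀ (K : Type*) [Field K] [NumberField K] [IsTotallyReal K],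
      -- The maximal order of a finite subgroup exists.
      (∀ n : ℕ, IsGreatest (finiteSubgroupOrders (𝓞 K) n) (maxFiniteSubgroupOrder (𝓞 K) n)) ∧
      LEUpToBigO (fun n => Real.log (maxFiniteSubgroupOrder (𝓞 K) n))
        (fun n => n * Real.log n) (fun n => n) ∧
      (Module.finrank ℚ K = 2 →
        (IsRationalsAdjoinSqrt K 2 →
          LEUpToBigO (fun n => Real.log (maxFiniteSubgroupOrder (𝓞 K) n))
            (fun n => n * Real.log n + (schurConstant + Real.log 2 / 2) * n)
            (fun n => Real.sqrt n * Real.log n)) ∧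
        (∀ p : ℕ, p.Prime → p ≡ 1 [MOD 4] → IsRationalsAdjoinSqrt K p →
          LEUpToBigO (fun n => Real.log (maxFiniteSubgroupOrder (𝓞 K) n))
            (fun n => n * Real.log n +
              (schurConstant + (p : ℝ) * Real.log p / ((p : ℝ) - 1) ^ 2) * n)
            (fun n => Real.sqrt n * Real.log n)) ∧
        (¬ IsRationalsAdjoinSqrt K 2 →
          (∀ p : ℕ, p.Prime → p ≡ 1 [MOD 4] → ¬ IsRationalsAdjoinSqrt K p) →
          LEUpToBigO (fun n => Real.log (maxFiniteSubgroupOrder (𝓞 K) n))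
            (fun n => n * Real.log n + schurConstant * n)
            (fun n => Real.sqrt n * Real.log n))) := by
  refine ⟨⟨summable_schurTerm, schurConstant_mem⟩, fun K _ _ _ =>
    ⟨isGreatest_maxFiniteSubgroupOrder,
    leUpToBigO_log_maxFiniteSubgroupOrder_natCast, fun hK =>
      ⟨leUpToBigO_of_isRationalsAdjoinSqrt_two hK,
        fun p hp _ hKp => leUpToBigO_of_isRationalsAdjoinSqrt_prime hK hp hKp,
        leUpToBigO_of_not_isRationalsAdjoinSqrt hK⟩⟩⟩
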